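/- **Lemma (Modal asymptotics).** Let $t_0>0$ and $\lambda\in\mathbb{C}$, and let $y:[t_0,\infty)\to\mathbb{C}$ solve $$\ddot y(t)+\frac{3}{t}\,\dot y(t)+\lambda\,y(t)=0\qquad(t\ge t_0)$$ with initial data $(y(t_0),\dot y(t_0))\in\mathbb{R}^2\setminus\{(0,0)\}$. Say that $|y(t)|\to\infty$ *exponentially at rate* $r$ if $|y(t)|\to\infty$ and $\frac1t\log|y(t)|\to r$ as $t\to\infty$. 1. If $\lambda>0$ is real, then $y(t)=O(t^{-3/2})$ as $t\to\infty$; in particular $y(t)\to0$. 2. If $\lambda=-\mu^2$ with $\mu>0$, then there are $c_1,c_2\in\mathbb{R}$ with $y(t)=\frac1t\left[c_1 I_1(\mu t)+c_2K_1(\mu t)\right]$ for all $t\ge t_0$, where $I_1,K_1$ are the modified Bessel functions of order $1$ of the first and second kind. Moreover, there is a one-dimensional linear subspace (a line) $L\subset\mathbb{R}^2$, of Lebesgue measure zero and depending only on $t_0$ and $\mu$, such that whenever $(y(t_0),\dot y(t_0))\notin L$, $|y(t)|\to\infty$ exponentially at rate $\mu$; more precisely, $|y(t)|\sim C\,e^{\mu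 t}\,t^{-3/2}$ as $t\to\infty$ for some constant $C>0$. 3. If $\lambda\in\mathbb{C}\setminus\mathbb{R}$ and $\sqrt\lambda=\alpha+i\beta$ is the principal square root, then $|\beta|>0$ and, for all nonzero real initial data, $|y(t)|\to\infty$ exponentially at rate $|\beta|$; more precisely, $|y(t)|\sim C\,e^{|\beta|t}\,t^{-3/2}$ as $t\to\infty$ for some constant $C>0$. 4. If $\lambda=0$, then $y(t)=c_1+c_2t^{-2}$ for all $t\ge t_0$ with constants $c_1,c_2\in\mathbb{C}$, and $y(t)\to c_1$ as $t\to\infty$. -/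

import Mathlib

open Filter Topology Asymptotics MeasureTheory

/-- `y` is a (classical, complex-valued) solution on `[t₀, ∞)` of
`y'' + (3 / t) y' + lam * y = 0` with real initial data `y(t₀) = a`, `y'(t₀) = b`.
At the left endpoint `t₀` derivatives are one-sided. -/
def SolvesModalIVP (lam : ℂ) (t₀ a b : ℝ) (y : ℝ → ℂ) : Prop :=
  ∃ y' y'' : ℝ → ℂ,
    (∀ t ∈ Set.Ici t₀, HasDerivWithinAt y (y' t) (Set.Ici t₀) t) ∧
    (∀ t ∈ Set.Ici t₀, HasDerivWithinAt y' (y'' t) (Set.Ici t₀) t) ∧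
    (∀ t ∈ Set.Ici t₀, y'' t + (3 / (t : ℂ)) * y' t + lam * y t = 0) ∧
    y t₀ = (a : ℂ) ∧ y' t₀ = (b : ℂ)

/-- `f` tends to infinity exponentially at rate `r`: `f t → ∞` and `log (f t) / t → r`. -/
def GrowsExponentiallyAtRate (f : ℝ → ℝ) (r : ℝ) : Prop :=
  Tendsto f atTop atTop ∧ Tendsto (fun t : ℝ => Real.log (f t) / t) atTop (𝓝 r)

/-- The modified Bessel function of the first kind of order one. -/
noncomputable def besselI₁ (x : ℝ) : ℝ :=
  ∑' k : ℕ, (x / 2) ^ (2 * k + 1) / ((k.factorial : ℝ) * ((k + 1).factorial : ℝ))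

/-- The modified Bessel function of the second kind of order one, for `x > 0`. -/
noncomputable def besselK₁ (x : ℝ) : ℝ :=
  ∫ s in Set.Ioi (0 : ℝ), Real.exp (-x * Real.cosh s) * Real.cosh s

/-- The principal square root of a complex number. -/
noncomputable def principalSqrt (z : ℂ) : ℂ := z ^ (1 / 2 : ℂ)

/-! With `w = t ^ (3 / 2) * y` and `κ ^ 2 = -lam` the equation becomes `w'' = (κ ^ 2 + 3 / (4 t ^
2)) w`, a constant-coefficient equation with an integrable perturbation. For `lam > 0` a Grönwall
bound on the energy `‖w'‖ ^ 2 + lam * ‖w‖ ^ 2` keeps `w` bounded.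

If `lam` is not real, or negative, `κ` can be chosen with `0 < κ.re`. The modes `w' + κ w` and `w' -
κ w` grow and decay, coupled only at order `t ^ (-2)`, so `exp (-κ t) * w` has a limit `A`; if `A =
0`, then `w` and `w'` both tend to zero (`exists_tendsto_exp_neg_mul`). Every growth claim thus
reduces to excluding `A = 0`.

For non-real `lam` the imaginary part of `conj w * w'` is monotone; it vanishes at `t₀` because the
data are real, and at infinity if `A = 0`, which forces `w = 0`. For `lam = -μ ^ 2`, `A = 0` kills
the `I₁` coefficient, since `I₁ (μ t) / t` stays above `μ / 2`; so `L` is the line of data of `K₁ (μ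
t) / t`. No asymptotic expansion of Bessel functions is needed, only their equations, signs and
crude bounds. -/

/-! ### Grönwall estimates -/

/-- A function on `[a, ∞)` with nonpositive derivative is antitone. -/
theorem antitoneOn_Ici_of_hasDerivWithinAt_nonpos {f f' : ℝ → ℝ} {a : ℝ}
    (hf : ∀ t ∈ Set.Ici a, HasDerivWithinAt f (f' t) (Set.Ici a) t)
    (hf' : ∀ t ∈ Set.Ici a, f' t ≤ 0) : AntitoneOn f (Set.Ici a) := by
  refine antitoneOn_of_hasDerivWithinAt_nonpos (f' := f') (convex_Ici a)
    (fun t ht => (hf t ht).continuousWithinAt) (fun t ht => ?_) (fun t ht => ?_)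
  · exact (hf t (interior_subset ht)).mono interior_subset
  · exact hf' t (interior_subset ht)

/-- A Grönwall inequality with rate `γ + c / t ^ 2`. -/
theorem antitoneOn_mul_exp_of_deriv_le {f f' : ℝ → ℝ} {T : ℝ} (hT : 0 < T) (γ c : ℝ)
    (hf : ∀ t ∈ Set.Ici T, HasDerivWithinAt f (f' t) (Set.Ici T) t)
    (hf' : ∀ t ∈ Set.Ici T, f' t ≤ (γ + c / t ^ 2) * f t) :
    AntitoneOn (fun t => f t * Real.exp (-γ * t + c / t)) (Set.Ici T) := by
  refine antitoneOn_Ici_of_hasDerivWithinAt_nonpos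
    (f' := fun t => (f' t - (γ + c / t ^ 2) * f t) * Real.exp (-γ * t + c / t))
    (fun t ht => ?_) (fun t ht => ?_)
  · have h0 : t ≠ 0 := (lt_of_lt_of_le hT ht).ne'
    have h1 : HasDerivAt (fun t : ℝ => -γ * t + c / t) (-γ * 1 + c * (-(t ^ 2)⁻¹)) t := by
      simpa only [div_eq_mul_inv, id] using
        ((hasDerivAt_id t).const_mul (-γ)).fun_add ((hasDerivAt_inv h0).const_mul c)
    refine ((hf t ht).mul h1.exp.hasDerivWithinAt).congr_deriv ?_
    rw [div_eq_mul_inv c (t ^ 2)]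
    ring
  · exact mul_nonpos_of_nonpos_of_nonneg (by linarith [hf' t ht]) (Real.exp_nonneg _)

/-- The growth bound that follows from the Grönwall inequality. -/
theorem exists_le_mul_exp_of_deriv_le {f f' : ℝ → ℝ} {T : ℝ} (hT : 0 < T) (γ : ℝ) {c : ℝ}
    (hc : 0 ≤ c)
    (hf : ∀ t ∈ Set.Ici T, HasDerivWithinAt f (f' t) (Set.Ici T) t)
    (hf' : ∀ t ∈ Set.Ici T, f' t ≤ (γ + c / t ^ 2) * f t) :
    ∃ M, 0 ≤ M ∧ ∀ t ∈ Set.Ici T, f t ≤ M * Real.exp (γ * t) := by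
  refine ⟨|f T| * Real.exp (-γ * T + c / T), by positivity, fun t ht => ?_⟩
  have h := antitoneOn_mul_exp_of_deriv_le hT γ c hf hf' Set.self_mem_Ici ht ht
  have ht0 : 0 < t := lt_of_lt_of_le hT ht
  have h2 : f t * Real.exp (-γ * t + c / t) ≤ |f T| * Real.exp (-γ * T + c / T) :=
    h.trans (mul_le_mul_of_nonneg_right (le_abs_self _) (Real.exp_nonneg _))
  have h3 : f t * Real.exp (c / t) ≤ |f T| * Real.exp (-γ * T + c / T) * Real.exp (γ * t) := by
    have := mul_le_mul_of_nonneg_right h2 (Real.exp_nonneg (γ * t))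
    rwa [mul_assoc, ← Real.exp_add, show -γ * t + c / t + γ * t = c / t by ring] at this
  -- The sign of `f` is not known; only where `f t ≥ 0` may the factor `exp (c / t) ≥ 1` be dropped.
  rcases le_total (f t) 0 with h4 | h4
  · exact h4.trans (by positivity)
  · refine le_trans ?_ h3
    exact le_mul_of_one_le_right h4 (Real.one_le_exp (by positivity))

/-- The squared norm along a differentiable curve in `ℂ`. -/
theorem HasDerivWithinAt.complex_normSq {f : ℝ → ℂ} {f' : ℂ} {s : Set ℝ} {t : ℝ}
    (hf : HasDerivWithinAt f f' s t) :
    HasDerivWithinAt (fun t => ‖f t‖ ^ 2) (2 * (starRingEnd ℂ (f t) * f').re) s t := by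
  refine hf.norm_sq.congr_deriv ?_
  rw [Complex.inner, mul_comm f']

/-! ### Dichotomy for weakly coupled growing and decaying modes -/

section Dichotomy

variable {X Y eX eY : ℝ → ℝ} {T r c : ℝ}

/-- Perturbed growing and decaying modes: the total energy grows at most at the unperturbed rate. -/
theorem exists_add_le_mul_exp (hT : 0 < T) (hr : 0 < r) (hc : 0 ≤ c)
    (hY0 : ∀ t, 0 ≤ Y t)
    (hX : ∀ t ∈ Set.Ici T, HasDerivWithinAt X (2 * r * X t + eX t) (Set.Ici T) t)
    (hY : ∀ t ∈ Set.Ici T, HasDerivWithinAt Y (-(2 * r) * Y t + eY t) (Set.Ici T) t)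
    (he : ∀ t ∈ Set.Ici T, |eX t| + |eY t| ≤ c / t ^ 2 * (X t + Y t)) :
    ∃ M, 0 ≤ M ∧ ∀ t ∈ Set.Ici T, X t + Y t ≤ M * Real.exp (2 * r * t) := by
  refine exists_le_mul_exp_of_deriv_le hT (2 * r) hc (fun t ht => (hX t ht).add (hY t ht))
    (fun t ht => ?_)
  have h1 := he t ht
  have h2 := le_abs_self (eX t)
  have h3 := le_abs_self (eY t)
  have h4 : 0 ≤ r * Y t := mul_nonneg hr.le (hY0 t)
  rw [add_mul]
  linarith

/-- The decaying mode is negligible with respect to the growing exponential. -/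
theorem tendsto_decaying_mul_exp_neg (hT : 0 < T) (hr : 0 < r) (hc : 0 ≤ c)
    (hY0 : ∀ t, 0 ≤ Y t)
    (hX : ∀ t ∈ Set.Ici T, HasDerivWithinAt X (2 * r * X t + eX t) (Set.Ici T) t)
    (hY : ∀ t ∈ Set.Ici T, HasDerivWithinAt Y (-(2 * r) * Y t + eY t) (Set.Ici T) t)
    (he : ∀ t ∈ Set.Ici T, |eX t| + |eY t| ≤ c / t ^ 2 * (X t + Y t)) :
    Tendsto (fun t => Y t * Real.exp (-(2 * r) * t)) atTop (𝓝 0) := by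
  obtain ⟨M, hM, hXY⟩ := exists_add_le_mul_exp hT hr hc hY0 hX hY he
  -- The barrier `K * exp (2 r t) / t ^ 2` absorbs the forcing `eY`: for `t ≥ 1 / r` the loss from
  -- differentiating `t ^ (-2)` is harmless, and `Y` minus the barrier decays like `exp (-2 r t)`.
  set S := max T (1 / r)
  have hS : 0 < S := lt_of_lt_of_le hT (le_max_left _ _)
  have hTS : Set.Ici S ⊆ Set.Ici T := Set.Ici_subset_Ici.2 (le_max_left _ _)
  set K := c * M / (2 * r)
  have hK : K * (2 * r) = c * M := div_mul_cancel₀ _ (by positivity)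
  have hK0 : 0 ≤ K := by positivity
  obtain ⟨D, hD, hfD⟩ := exists_le_mul_exp_of_deriv_le
    (f := fun t => Y t - K * (Real.exp (2 * r * t) * (t ^ 2)⁻¹))
    (f' := fun t => -(2 * r) * Y t + eY t - K * (Real.exp (2 * r * t) * (2 * r) * (t ^ 2)⁻¹
      + Real.exp (2 * r * t) * (-(2 * t) / (t ^ 2) ^ 2)))
    hS (-(2 * r)) le_rfl
    (fun t ht => by
      have ht0 : t ≠ 0 := (lt_of_lt_of_le hS ht).ne'
      have h1 : HasDerivAt (fun t : ℝ => Real.exp (2 * r * t)) (Real.exp (2 * r * t) * (2 * r)) t := by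
        simpa using ((hasDerivAt_id t).const_mul (2 * r)).exp
      have h2 : HasDerivAt (fun t : ℝ => (t ^ 2)⁻¹) (-(2 * t) / (t ^ 2) ^ 2) t := by
        simpa using (hasDerivAt_pow 2 t).fun_inv (pow_ne_zero 2 ht0)
      exact ((hY t (hTS ht)).mono hTS).sub ((h1.mul h2).const_mul K).hasDerivWithinAt)
    (fun t ht => by
      have ht0 : 0 < t := lt_of_lt_of_le hS ht
      have hrt : 1 / r ≤ t := (le_max_right _ _).trans ht
      have h1 : 1 / t ≤ r := by
        rw [div_le_iff₀ ht0]; rwa [div_le_iff₀ hr, mul_comm] at hrt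
      have h2 : eY t ≤ c / t ^ 2 * (M * Real.exp (2 * r * t)) := by
        have := he t (hTS ht)
        have h3 := mul_le_mul_of_nonneg_left (hXY t (hTS ht)) (show 0 ≤ c / t ^ 2 by positivity)
        linarith [le_abs_self (eY t), abs_nonneg (eX t)]
      have h3 : -(2 * t) / (t ^ 2) ^ 2 = -(2 * (1 / t)) * (t ^ 2)⁻¹ := by
        field_simp
      have h4 : c / t ^ 2 * (M * Real.exp (2 * r * t))
          = K * (2 * r) * (Real.exp (2 * r * t) * (t ^ 2)⁻¹) := by
        rw [hK]; ring
      have h5 : 0 ≤ K * (Real.exp (2 * r * t) * (t ^ 2)⁻¹) * (r - 1 / t) :=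
        mul_nonneg (by positivity) (by linarith)
      simp only [zero_div, add_zero]
      rw [h3]
      nlinarith [h2, h4, h5])
  refine squeeze_zero' (g := fun t => K * (t ^ 2)⁻¹ + D * Real.exp (-(4 * r) * t))
    (Eventually.of_forall fun t => mul_nonneg (hY0 t) (Real.exp_nonneg _)) ?_ ?_
  · filter_upwards [eventually_ge_atTop S] with t ht
    have h := mul_le_mul_of_nonneg_right (hfD t ht) (Real.exp_nonneg (-(2 * r) * t))
    rw [sub_mul, mul_assoc D, ← Real.exp_add] at h
    have h1 : Real.exp (2 * r * t) * Real.exp (-(2 * r) * t) = 1 := by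
      rw [← Real.exp_add, show 2 * r * t + -(2 * r) * t = 0 by ring, Real.exp_zero]
    have h2 : K * (Real.exp (2 * r * t) * (t ^ 2)⁻¹) * Real.exp (-(2 * r) * t) = K * (t ^ 2)⁻¹ := by
      calc _ = K * (t ^ 2)⁻¹ * (Real.exp (2 * r * t) * Real.exp (-(2 * r) * t)) := by ring
        _ = _ := by rw [h1, mul_one]
    rw [h2, show -(2 * r) * t + -(2 * r) * t = -(4 * r) * t by ring] at h
    linarith
  · have h1 : Tendsto (fun t : ℝ => (t ^ 2)⁻¹) atTop (𝓝 0) :=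
      (tendsto_pow_atTop two_ne_zero).inv_tendsto_atTop
    have h2 : Tendsto (fun t : ℝ => Real.exp (-(4 * r) * t)) atTop (𝓝 0) :=
      Real.tendsto_exp_atBot.comp (tendsto_id.const_mul_atTop_of_neg (by linarith))
    simpa using (h1.const_mul K).add (h2.const_mul D)

/-- If the growing mode is negligible with respect to the growing exponential, then both modes
tend to zero. -/
theorem tendsto_zero_of_tendsto_growing_mul_exp_neg (hT : 0 < T) (hr : 0 < r) (hc : 0 ≤ c)
    (hX0 : ∀ t, 0 ≤ X t) (hY0 : ∀ t, 0 ≤ Y t)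
    (hX : ∀ t ∈ Set.Ici T, HasDerivWithinAt X (2 * r * X t + eX t) (Set.Ici T) t)
    (hY : ∀ t ∈ Set.Ici T, HasDerivWithinAt Y (-(2 * r) * Y t + eY t) (Set.Ici T) t)
    (he : ∀ t ∈ Set.Ici T, |eX t| + |eY t| ≤ c / t ^ 2 * (X t + Y t))
    (hlim : Tendsto (fun t => X t * Real.exp (-(2 * r) * t)) atTop (𝓝 0)) :
    Tendsto X atTop (𝓝 0) ∧ Tendsto Y atTop (𝓝 0) := by
  obtain ⟨S, hTS, hS⟩ : ∃ S, T ≤ S ∧ ∀ t, S ≤ t → c / t ^ 2 ≤ 2 * r := by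
    have h1 : Tendsto (fun t : ℝ => c / t ^ 2) atTop (𝓝 0) :=
      (tendsto_pow_atTop two_ne_zero).const_div_atTop c
    obtain ⟨S, hS⟩ := eventually_atTop.1 (h1.eventually_le_const (show 0 < 2 * r by positivity))
    exact ⟨max T S, le_max_left _ _, fun t ht => hS t ((le_max_right _ _).trans ht)⟩
  have hS0 : 0 < S := lt_of_lt_of_le hT hTS
  -- Cone argument: past `S`, `(X - Y)' ≥ (2 r - c / t ^ 2) (X - Y)`. Were `X > Y` at one time, `X *
  -- exp (-2 r t)` would stay above a positive constant, against `hlim`.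
  have hcone : ∀ s, S ≤ s → X s ≤ Y s := by
    intro s hs
    by_contra! hlt
    have hs0 : 0 < s := lt_of_lt_of_le hS0 hs
    have hTs : Set.Ici s ⊆ Set.Ici T := Set.Ici_subset_Ici.2 (hTS.trans hs)
    have hanti := antitoneOn_mul_exp_of_deriv_le (f := fun t => Y t - X t) hs0 (2 * r) (-c)
      (fun t ht => ((hY t (hTs ht)).mono hTs).sub ((hX t (hTs ht)).mono hTs))
      (fun t ht => by
        have h1 := he t (hTs ht)
        have h2 := hS t (hs.trans ht)
        have h3 := neg_abs_le (eX t)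
        have h4 := le_abs_self (eY t)
        have h5 := mul_nonneg (sub_nonneg.2 h2) (hY0 t)
        rw [neg_div]
        nlinarith)
    have hle : ∀ᶠ t in atTop, (X s - Y s) * Real.exp (-(2 * r) * s + -c / s)
        ≤ X t * Real.exp (-(2 * r) * t) := by
      filter_upwards [eventually_ge_atTop s] with t ht
      have ht0 : 0 < t := hs0.trans_le ht
      have h1 := hanti Set.self_mem_Ici ht ht
      simp only at h1
      have h2 : Real.exp (-(2 * r) * t + -c / t) ≤ Real.exp (-(2 * r) * t) := by
        apply Real.exp_le_exp.2
        have : 0 ≤ c / t := by positivity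
        rw [neg_div]; linarith
      have h3 := mul_le_mul_of_nonneg_left h2 (hX0 t)
      have h4 := mul_nonneg (hY0 t) (Real.exp_nonneg (-(2 * r) * t + -c / t))
      linarith
    have := ge_of_tendsto hlim hle
    have h6 : 0 < (X s - Y s) * Real.exp (-(2 * r) * s + -c / s) :=
      mul_pos (by linarith) (Real.exp_pos _)
    linarith
  have hST : Set.Ici S ⊆ Set.Ici T := Set.Ici_subset_Ici.2 hTS
  -- Since `X ≤ Y`, the error is at most `2 c / t ^ 2 * Y`, so `Y` decays and carries `X` with it.
  obtain ⟨M, hM, hYM⟩ := exists_le_mul_exp_of_deriv_le hS0 (-(2 * r))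
    (show 0 ≤ 2 * c by positivity)
    (fun t ht => (hY t (hST ht)).mono hST)
    (fun t ht => by
      have ht0 : 0 < t := hS0.trans_le ht
      have h1 := he t (hST ht)
      have h2 := mul_le_mul_of_nonneg_left (hcone t ht) (show 0 ≤ c / t ^ 2 by positivity)
      have h3 := abs_nonneg (eX t)
      have h4 := le_abs_self (eY t)
      rw [mul_div_assoc]
      linarith)
  have hexp : Tendsto (fun t : ℝ => M * Real.exp (-(2 * r) * t)) atTop (𝓝 0) := by
    have h2 : Tendsto (fun t : ℝ => Real.exp (-(2 * r) * t)) atTop (𝓝 0) :=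
      Real.tendsto_exp_atBot.comp (tendsto_id.const_mul_atTop_of_neg (by linarith))
    simpa using h2.const_mul M
  constructor
  · refine squeeze_zero' (Eventually.of_forall hX0) ?_ hexp
    filter_upwards [eventually_ge_atTop S] with t ht using (hcone t ht).trans (hYM t ht)
  · refine squeeze_zero' (Eventually.of_forall hY0) ?_ hexp
    filter_upwards [eventually_ge_atTop S] with t ht using hYM t ht

end Dichotomy

/-! ### Liouville transform and asymptotic amplitude -/

/-- The Liouville transform `w = t ^ (3 / 2) * y` removes the first order term of the equation. -/
theorem SolvesModalIVP.liouville {lam : ℂ} {t₀ a b : ℝ} (ht₀ : 0 < t₀) {y : ℝ → ℂ}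
    (hy : SolvesModalIVP lam t₀ a b y) :
    ∃ w' : ℝ → ℂ,
      (∀ t ∈ Set.Ici t₀, HasDerivWithinAt (fun t : ℝ => ((t ^ (3 / 2 : ℝ) : ℝ) : ℂ) * y t)
        (w' t) (Set.Ici t₀) t) ∧
      (∀ t ∈ Set.Ici t₀, HasDerivWithinAt w'
        ((-lam + 3 / (4 * (t : ℂ) ^ 2)) * (((t ^ (3 / 2 : ℝ) : ℝ) : ℂ) * y t)) (Set.Ici t₀) t) ∧
      w' t₀ = ((t₀ ^ (3 / 2 : ℝ) : ℝ) : ℂ) * (b + 3 / 2 / t₀ * a) := by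
  obtain ⟨y', y'', hy', hy'', hode, ha, hb⟩ := hy
  have hp : ∀ t ∈ Set.Ici t₀, HasDerivWithinAt (fun t : ℝ => ((t ^ (3 / 2 : ℝ) : ℝ) : ℂ))
      (3 / 2 / t * ((t ^ (3 / 2 : ℝ) : ℝ) : ℂ)) (Set.Ici t₀) t := by
    intro t ht
    have ht0 : 0 < t := ht₀.trans_le ht
    have h := (Real.hasDerivAt_rpow_const (p := 3 / 2) (Or.inl ht0.ne')).ofReal_comp
    refine h.hasDerivWithinAt.congr_deriv ?_
    rw [Real.rpow_sub_one ht0.ne']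
    push_cast
    ring
  refine ⟨fun t => ((t ^ (3 / 2 : ℝ) : ℝ) : ℂ) * (y' t + 3 / 2 * ((t : ℂ)⁻¹ * y t)),
    fun t ht => ?_, fun t ht => ?_, ?_⟩
  · refine ((hp t ht).mul (hy' t ht)).congr_deriv ?_
    ring
  · have ht0 : t ≠ 0 := (ht₀.trans_le ht).ne'
    have htc : (t : ℂ) ≠ 0 := by exact_mod_cast ht0
    have hinv : HasDerivWithinAt (fun t : ℝ => (t : ℂ)⁻¹) (-((t : ℂ) ^ 2)⁻¹) (Set.Ici t₀) t := by
      have := (hasDerivAt_inv ht0).ofReal_comp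
      push_cast at this
      exact this.hasDerivWithinAt
    refine ((hp t ht).mul ((hy'' t ht).add ((hinv.mul (hy' t ht)).const_mul (3 / 2)))).congr_deriv ?_
    have h := hode t ht
    have h2 : y'' t = -lam * y t - 3 / t * y' t := by linear_combination h
    rw [h2]
    simp only [Pi.mul_apply, Pi.add_apply]
    field_simp
    ring
  · beta_reduce
    rw [ha, hb]
    ring

/-- Solutions of `w'' = (κ ^ 2 + 3 / (4 t ^ 2)) w` with `0 < re κ` have an asymptotic amplitude
with respect to `exp (κ t)`; if it vanishes, then the solution decays. -/
theorem exists_tendsto_exp_neg_mul {κ : ℂ} (hκ : 0 < κ.re) {T : ℝ} (hT : 0 < T) {w w' : ℝ → ℂ}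
    (hw : ∀ t ∈ Set.Ici T, HasDerivWithinAt w (w' t) (Set.Ici T) t)
    (hw' : ∀ t ∈ Set.Ici T,
      HasDerivWithinAt w' ((κ ^ 2 + 3 / (4 * (t : ℂ) ^ 2)) * w t) (Set.Ici T) t) :
    ∃ A : ℂ, Tendsto (fun t : ℝ => Complex.exp (-κ * t) * w t) atTop (𝓝 A) ∧
      (A = 0 → Tendsto w atTop (𝓝 0) ∧ Tendsto w' atTop (𝓝 0)) := by
  have hκ0 : κ ≠ 0 := by rintro rfl; simp at hκ
  have hκn : 0 < ‖κ‖ := norm_pos_iff.2 hκ0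
  -- These combinations diagonalize the unperturbed system, with eigenvalues `κ` and `-κ`.
  set u : ℝ → ℂ := fun t => w' t + κ * w t
  set v : ℝ → ℂ := fun t => w' t - κ * w t
  set g : ℝ → ℂ := fun t => 3 / (4 * (t : ℂ) ^ 2) * w t
  have hu : ∀ t ∈ Set.Ici T, HasDerivWithinAt u (κ * u t + g t) (Set.Ici T) t := fun t ht =>
    ((hw' t ht).add ((hw t ht).const_mul κ)).congr_deriv (by simp only [u, g]; ring)
  have hv : ∀ t ∈ Set.Ici T, HasDerivWithinAt v (-κ * v t + g t) (Set.Ici T) t := fun t ht =>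
    ((hw' t ht).sub ((hw t ht).const_mul κ)).congr_deriv (by simp only [v, g]; ring)
  have hw_eq : ∀ t, w t = (u t - v t) / (2 * κ) := fun t => by
    simp only [u, v]; field_simp; ring
  have hw'_eq : ∀ t, w' t = (u t + v t) / 2 := fun t => by
    simp only [u, v]; ring
  have hw_le : ∀ t, ‖w t‖ ≤ (‖u t‖ + ‖v t‖) / (2 * ‖κ‖) := fun t => by
    rw [hw_eq, norm_div, norm_mul, Complex.norm_two]
    gcongr
    exact norm_sub_le _ _
  have hg_eq : ∀ t, ‖g t‖ = 3 / 4 * (t ^ 2)⁻¹ * ‖w t‖ := fun t => by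
    simp only [g, norm_mul, norm_div, norm_pow, Complex.norm_real, Complex.norm_ofNat,
      Real.norm_eq_abs, sq_abs]
    ring
  set c := 3 / (2 * ‖κ‖) with hc_def
  have hc : 0 ≤ c := by positivity
  have hX : ∀ t ∈ Set.Ici T, HasDerivWithinAt (fun t => ‖u t‖ ^ 2)
      (2 * κ.re * ‖u t‖ ^ 2 + 2 * (starRingEnd ℂ (u t) * g t).re) (Set.Ici T) t := fun t ht => by
    refine (hu t ht).complex_normSq.congr_deriv ?_
    rw [← Complex.normSq_eq_norm_sq, Complex.normSq_apply]
    simp only [Complex.mul_re, Complex.add_re, Complex.add_im, Complex.mul_im, Complex.conj_re,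
      Complex.conj_im]
    ring
  have hY : ∀ t ∈ Set.Ici T, HasDerivWithinAt (fun t => ‖v t‖ ^ 2)
      (-(2 * κ.re) * ‖v t‖ ^ 2 + 2 * (starRingEnd ℂ (v t) * g t).re) (Set.Ici T) t := fun t ht => by
    refine (hv t ht).complex_normSq.congr_deriv ?_
    rw [← Complex.normSq_eq_norm_sq, Complex.normSq_apply]
    simp only [Complex.mul_re, Complex.add_re, Complex.add_im, Complex.mul_im, Complex.conj_re,
      Complex.conj_im, Complex.neg_re, Complex.neg_im]
    ring
  have he_aux : ∀ (z : ℂ) t, |2 * (starRingEnd ℂ z * g t).re| ≤ 2 * (‖z‖ * ‖g t‖) := fun z t => by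
    rw [abs_mul, abs_two]
    gcongr
    refine (Complex.abs_re_le_norm _).trans ?_
    rw [norm_mul, Complex.norm_conj]
  have he : ∀ t ∈ Set.Ici T, |2 * (starRingEnd ℂ (u t) * g t).re|
      + |2 * (starRingEnd ℂ (v t) * g t).re| ≤ c / t ^ 2 * (‖u t‖ ^ 2 + ‖v t‖ ^ 2) := fun t ht => by
    have ht0 : 0 < t := hT.trans_le ht
    calc _ ≤ 2 * (‖u t‖ * ‖g t‖) + 2 * (‖v t‖ * ‖g t‖) := add_le_add (he_aux _ _) (he_aux _ _)
      _ = 2 * (‖u t‖ + ‖v t‖) * (3 / 4 * (t ^ 2)⁻¹ * ‖w t‖) := by rw [hg_eq]; ring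
      _ ≤ 2 * (‖u t‖ + ‖v t‖) * (3 / 4 * (t ^ 2)⁻¹ * ((‖u t‖ + ‖v t‖) / (2 * ‖κ‖))) := by
        gcongr
        exact hw_le t
      _ = c / t ^ 2 * ((‖u t‖ + ‖v t‖) ^ 2 / 2) := by rw [hc_def]; field_simp; ring
      _ ≤ _ := by
        gcongr
        nlinarith [sq_nonneg (‖u t‖ - ‖v t‖)]
  have hsq : ∀ z : ℝ → ℂ, ∀ t, 0 ≤ ‖z t‖ ^ 2 := fun z t => sq_nonneg _
  have hexp : ∀ (z : ℂ) (t : ℝ), ‖Complex.exp (-κ * t) * z‖ ^ 2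
      = ‖z‖ ^ 2 * Real.exp (-(2 * κ.re) * t) := fun z t => by
    rw [norm_mul, Complex.norm_exp, mul_pow, ← Real.exp_nat_mul, mul_comm]
    congr 2
    simp
    ring
  have htend : ∀ z : ℝ → ℂ, Tendsto (fun t => ‖z t‖ ^ 2) atTop (𝓝 0) ↔ Tendsto z atTop (𝓝 0) :=
    fun z => by
      rw [tendsto_zero_iff_norm_tendsto_zero (f := z)]
      refine ⟨fun h => ?_, fun h => by simpa using h.pow 2⟩
      have := (Real.continuous_sqrt.tendsto 0).comp h
      rw [Real.sqrt_zero] at this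
      exact this.congr fun t => Real.sqrt_sq (norm_nonneg _)
  have hV : Tendsto (fun t : ℝ => Complex.exp (-κ * t) * v t) atTop (𝓝 0) := by
    rw [← htend]
    simp only [hexp]
    exact tendsto_decaying_mul_exp_neg hT hκ hc (hsq v) hX hY he
  -- The derivative of `exp (-κ t) * u` is `exp (-κ t) * g`, which the energy bound makes `O(t ^
  -- (-2))`, hence integrable.
  obtain ⟨B, hB⟩ : ∃ B, Tendsto (fun t : ℝ => Complex.exp (-κ * t) * u t) atTop (𝓝 B) := by
    obtain ⟨M, hM, hXY⟩ := exists_add_le_mul_exp hT hκ hc (hsq v) hX hY he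
    refine ⟨_, tendsto_limUnder_of_hasDerivAt_of_integrableOn_Ioi (a := T)
      (f' := fun t => Complex.exp (-κ * t) * g t) (fun t ht => ?_) ?_⟩
    · have h1 : HasDerivAt (fun t : ℝ => Complex.exp (-κ * t)) (Complex.exp (-κ * t) * -κ) t := by
        simpa using ((hasDerivAt_id t).ofReal_comp.const_mul (-κ)).cexp
      refine (h1.mul ((hu t (Set.mem_Ioi.1 ht).le).hasDerivAt (Ici_mem_nhds ht))).congr_deriv ?_
      ring
    · have hint : IntegrableOn (fun t : ℝ => 3 / 4 * (√(2 * M) / (2 * ‖κ‖)) * t ^ (-2 : ℝ))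
          (Set.Ioi T) := (integrableOn_Ioi_rpow_of_lt (by norm_num) hT).const_mul _
      refine Integrable.mono' hint (ContinuousOn.aestronglyMeasurable ?_ measurableSet_Ioi)
        ((ae_restrict_iff' measurableSet_Ioi).2 (Eventually.of_forall fun t ht => ?_))
      · have hwc : ContinuousOn w (Set.Ioi T) := fun t ht =>
          (hw t (Set.mem_Ioi.1 ht).le).continuousWithinAt.mono Set.Ioi_subset_Ici_self
        refine ContinuousOn.mul (by fun_prop) (ContinuousOn.mul ?_ hwc)
        refine continuousOn_const.div (by fun_prop) fun t ht => ?_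
        have : (t : ℂ) ≠ 0 := by exact_mod_cast (hT.trans ht).ne'
        exact mul_ne_zero (by norm_num) (pow_ne_zero 2 this)
      · have ht' : T ≤ t := (Set.mem_Ioi.1 ht).le
        have ht0 : 0 < t := hT.trans_le ht'
        have h1 : ‖u t‖ + ‖v t‖ ≤ √(2 * M) * Real.exp (κ.re * t) := by
          have h2 : (‖u t‖ + ‖v t‖) ^ 2 ≤ (√(2 * M) * Real.exp (κ.re * t)) ^ 2 := by
            rw [mul_pow, Real.sq_sqrt (by positivity), ← Real.exp_nat_mul]
            have h3 := hXY t ht'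
            have h4 : ((2 : ℕ) : ℝ) * (κ.re * t) = 2 * κ.re * t := by push_cast; ring
            rw [h4]
            nlinarith [sq_nonneg (‖u t‖ - ‖v t‖)]
          exact le_of_sq_le_sq h2 (by positivity)
        have h5 : ‖Complex.exp (-κ * t)‖ = Real.exp (-(κ.re * t)) := by
          rw [Complex.norm_exp]; simp
        rw [norm_mul, h5, hg_eq, Real.rpow_neg ht0.le, Real.rpow_two]
        calc _ ≤ Real.exp (-(κ.re * t)) * (3 / 4 * (t ^ 2)⁻¹
              * (√(2 * M) * Real.exp (κ.re * t) / (2 * ‖κ‖))) := by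
              gcongr
              exact (hw_le t).trans (by gcongr)
          _ = 3 / 4 * (√(2 * M) / (2 * ‖κ‖)) * (t ^ 2)⁻¹
              * (Real.exp (-(κ.re * t)) * Real.exp (κ.re * t)) := by ring
          _ = _ := by rw [← Real.exp_add, neg_add_cancel, Real.exp_zero, mul_one]
  refine ⟨B / (2 * κ), ?_, fun hA => ?_⟩
  · have := (hB.sub hV).div_const (2 * κ)
    rw [sub_zero] at this
    refine this.congr fun t => ?_
    rw [hw_eq]
    ring
  · have hB0 : B = 0 := by
      rcases div_eq_zero_iff.1 hA with h | h
      · exact h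
      · exact absurd h (mul_ne_zero two_ne_zero hκ0)
    rw [hB0, ← htend] at hB
    simp only [hexp] at hB
    obtain ⟨h1, h2⟩ := tendsto_zero_of_tendsto_growing_mul_exp_neg hT hκ hc (hsq u) (hsq v) hX hY he hB
    rw [htend] at h1 h2
    constructor
    · have := (h1.sub h2).div_const (2 * κ)
      rw [sub_zero, zero_div] at this
      exact this.congr fun t => (hw_eq t).symm
    · have := (h1.add h2).div_const 2
      rw [add_zero, zero_div] at this
      exact this.congr fun t => (hw'_eq t).symm

/-! ### From amplitude to exponential growth -/

/-- An asymptotic equivalence with `C * exp (r t) * t ^ (-3 / 2)` gives exponential growth. -/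
theorem growsExponentiallyAtRate_of_isEquivalent {f : ℝ → ℝ} {r C : ℝ} (hr : 0 < r) (hC : 0 < C)
    (hf : f ~[atTop] fun t : ℝ => C * (Real.exp (r * t) * t ^ (-(3 / 2) : ℝ))) :
    GrowsExponentiallyAtRate f r := by
  have hg : Tendsto (fun t : ℝ => C * (Real.exp (r * t) * t ^ (-(3 / 2) : ℝ))) atTop atTop := by
    refine Tendsto.const_mul_atTop hC ?_
    refine (tendsto_exp_mul_div_rpow_atTop (3 / 2) r hr).congr' ?_
    filter_upwards [eventually_ge_atTop 0] with t ht
    rw [Real.rpow_neg ht, div_eq_mul_inv]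
  refine ⟨hf.symm.tendsto_atTop hg, ?_⟩
  have hg0 : ∀ᶠ t : ℝ in atTop, C * (Real.exp (r * t) * t ^ (-(3 / 2) : ℝ)) ≠ 0 :=
    hg.eventually_ne_atTop 0
  have hquot := (isEquivalent_iff_tendsto_one hg0).1 hf
  have h1 : Tendsto (fun t => Real.log ((f / fun t : ℝ => C * (Real.exp (r * t)
      * t ^ (-(3 / 2) : ℝ))) t)) atTop (𝓝 0) := by
    simpa using hquot.log one_ne_zero
  have h2 : Tendsto (fun t : ℝ => Real.log t / t) atTop (𝓝 0) := by
    simpa using Real.isLittleO_log_id_atTop.tendsto_div_nhds_zero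
  have h3 : Tendsto (fun t : ℝ => (Real.log ((f / fun t : ℝ => C * (Real.exp (r * t)
      * t ^ (-(3 / 2) : ℝ))) t) + Real.log C) * t⁻¹ + r + -(3 / 2) * (Real.log t / t))
      atTop (𝓝 ((0 + Real.log C) * 0 + r + -(3 / 2) * 0)) :=
    (((h1.add_const _).mul tendsto_inv_atTop_zero).add_const r).add (h2.const_mul _)
  rw [mul_zero, mul_zero, zero_add, add_zero] at h3
  refine h3.congr' ?_
  filter_upwards [eventually_gt_atTop 0, (hf.symm.tendsto_atTop hg).eventually_gt_atTop 0]
    with t ht hft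
  have hpt : 0 < t ^ (-(3 / 2) : ℝ) := Real.rpow_pos_of_pos ht _
  rw [Pi.div_apply, Real.log_div hft.ne' (by positivity), Real.log_mul hC.ne' (by positivity),
    Real.log_mul (Real.exp_ne_zero _) hpt.ne', Real.log_exp, Real.log_rpow ht]
  field_simp
  ring

/-- A nonzero asymptotic amplitude gives the asymptotic growth of the solution. -/
theorem growth_of_tendsto_amplitude {κ A : ℂ} (hκ : 0 < κ.re) (hA : A ≠ 0) {y : ℝ → ℂ}
    (h : Tendsto (fun t : ℝ => Complex.exp (-κ * t) * (((t ^ (3 / 2 : ℝ) : ℝ) : ℂ) * y t))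
      atTop (𝓝 A)) :
    GrowsExponentiallyAtRate (fun t => ‖y t‖) κ.re ∧
      ∃ C : ℝ, 0 < C ∧ (fun t => ‖y t‖) ~[atTop]
        (fun t : ℝ => C * (Real.exp (κ.re * t) * t ^ (-(3 / 2) : ℝ))) := by
  have hC : 0 < ‖A‖ := norm_pos_iff.2 hA
  have key : (fun t => ‖y t‖) ~[atTop]
      (fun t : ℝ => ‖A‖ * (Real.exp (κ.re * t) * t ^ (-(3 / 2) : ℝ))) := by
    rw [isEquivalent_iff_tendsto_one]
    · have h1 := h.norm.div_const ‖A‖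
      rw [div_self hC.ne'] at h1
      refine h1.congr' ?_
      filter_upwards [eventually_gt_atTop 0] with t ht
      have hpt : 0 < t ^ (3 / 2 : ℝ) := Real.rpow_pos_of_pos ht _
      have h5 : ‖Complex.exp (-κ * t)‖ = (Real.exp (κ.re * t))⁻¹ := by
        rw [Complex.norm_exp, ← Real.exp_neg]; simp
      rw [Pi.div_apply, norm_mul, norm_mul, h5, Complex.norm_real, Real.norm_of_nonneg hpt.le,
        Real.rpow_neg ht.le]
      field_simp
    · filter_upwards [eventually_gt_atTop 0] with t ht
      have hpt : 0 < t ^ (-(3 / 2) : ℝ) := Real.rpow_pos_of_pos ht _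
      positivity
  exact ⟨growsExponentiallyAtRate_of_isEquivalent hκ hC key, ‖A‖, hC, key⟩

/-! ### Power series for `I₁` -/

/-- The entire function `∑ z ^ k / (k! (k + m)!)`, a rescaled modified Bessel function of the
first kind of order `m`. -/
noncomputable def besselSeries (m : ℕ) (z : ℝ) : ℝ :=
  ∑' k : ℕ, z ^ k / ((k.factorial : ℝ) * ((k + m).factorial : ℝ))

theorem one_le_factorial_cast (n : ℕ) : (1 : ℝ) ≤ (n.factorial : ℝ) := by
  exact_mod_cast n.factorial_pos

theorem norm_pow_div_factorial_mul_le {z R : ℝ} (hz : |z| ≤ R) (k n : ℕ) :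
    ‖z ^ k / ((k.factorial : ℝ) * (n.factorial : ℝ))‖ ≤ R ^ k / (k.factorial : ℝ) := by
  have h1 := one_le_factorial_cast k
  have h2 := one_le_factorial_cast n
  rw [norm_div, norm_pow, Real.norm_eq_abs, Real.norm_of_nonneg (by positivity)]
  have : (k.factorial : ℝ) ≤ k.factorial * n.factorial := le_mul_of_one_le_right (by linarith) h2
  have hR : 0 ≤ R := (abs_nonneg z).trans hz
  gcongr

theorem summable_besselSeries (m : ℕ) (z : ℝ) :
    Summable fun k : ℕ => z ^ k / ((k.factorial : ℝ) * ((k + m).factorial : ℝ)) :=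
  Summable.of_norm_bounded (Real.summable_pow_div_factorial |z|)
    fun k => norm_pow_div_factorial_mul_le le_rfl k (k + m)

/-- Cancelling `k` against `k!` and shifting the index raises the order by one; the exponential
series dominates the differentiated terms on a ball. -/
theorem hasDerivAt_besselSeries (m : ℕ) (z : ℝ) :
    HasDerivAt (besselSeries m) (besselSeries (m + 1) z) z := by
  set R := |z| + 1
  have hR : 0 < R := by positivity
  have hz : z ∈ Metric.ball (0 : ℝ) R := by simp [R]
  have hshift : ∀ (y : ℝ) (k : ℕ), ((k + 1 : ℕ) : ℝ) * y ^ k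
      / (((k + 1).factorial : ℝ) * ((k + 1 + m).factorial : ℝ))
      = y ^ k / ((k.factorial : ℝ) * ((k + (m + 1)).factorial : ℝ)) := by
    intro y k
    have h1 := one_le_factorial_cast k
    have h2 := one_le_factorial_cast (k + (m + 1))
    rw [show k + 1 + m = k + (m + 1) by ring, Nat.factorial_succ k]
    push_cast
    have h3 : (k : ℝ) + 1 ≠ 0 := by positivity
    have h4 : (k.factorial : ℝ) ≠ 0 := by positivity
    have h5 : ((k + (m + 1)).factorial : ℝ) ≠ 0 := by positivity
    field_simp
  -- At `k = 0` the truncated `k - 1` is `0`, but the factor `k` kills the term; hence the case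
  -- distinction.
  have hbound : ∀ k : ℕ, ∀ y ∈ Metric.ball (0 : ℝ) R, ‖(k : ℝ) * y ^ (k - 1)
      / ((k.factorial : ℝ) * ((k + m).factorial : ℝ))‖
      ≤ if k = 0 then 0 else R ^ (k - 1) / ((k - 1).factorial : ℝ) := by
    intro k y hy
    have hy' : |y| ≤ R := by simpa using (Metric.mem_ball.1 hy).le
    cases k with
    | zero => simp
    | succ k =>
      simp only [Nat.add_sub_cancel, Nat.succ_ne_zero, if_false]
      rw [hshift]
      exact norm_pow_div_factorial_mul_le hy' k _
  have hsum : Summable fun k : ℕ => if k = 0 then 0 else R ^ (k - 1) / ((k - 1).factorial : ℝ) := by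
    rw [← summable_nat_add_iff 1]
    simpa using Real.summable_pow_div_factorial R
  have h := hasDerivAt_tsum_of_isPreconnected hsum Metric.isOpen_ball
    (convex_ball (0 : ℝ) R).isPreconnected
    (g := fun (k : ℕ) z => z ^ k / ((k.factorial : ℝ) * ((k + m).factorial : ℝ)))
    (fun k y _ => (hasDerivAt_pow k y).div_const _) hbound hz (summable_besselSeries m z) hz
  refine h.congr_deriv ?_
  rw [Summable.tsum_eq_zero_add (Summable.of_norm_bounded hsum fun k => hbound k z hz)]
  simp only [CharP.cast_eq_zero, zero_mul, zero_div, zero_add, Nat.add_sub_cancel]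
  exact tsum_congr fun k => hshift z k

/-- As differentiation raises the order, this is the equation `z G'' + 2 G' = G` for `G =
besselSeries 1`; it holds coefficientwise because `(k + 2)! = (k + 2) (k + 1)!`. -/
theorem besselSeries_recurrence (z : ℝ) :
    z * besselSeries 3 z + 2 * besselSeries 2 z = besselSeries 1 z := by
  have h3 : z * besselSeries 3 z = ∑' k : ℕ, (k : ℝ) * z ^ k
      / ((k.factorial : ℝ) * ((k + 2).factorial : ℝ)) ∧ Summable fun k : ℕ => (k : ℝ) * z ^ k
      / ((k.factorial : ℝ) * ((k + 2).factorial : ℝ)) := by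
    have hterm : ∀ k : ℕ, ((k + 1 : ℕ) : ℝ) * z ^ (k + 1)
        / (((k + 1).factorial : ℝ) * ((k + 1 + 2).factorial : ℝ))
        = z * (z ^ k / ((k.factorial : ℝ) * ((k + 3).factorial : ℝ))) := by
      intro k
      have h1 := one_le_factorial_cast k
      have h2 := one_le_factorial_cast (k + 3)
      rw [show k + 1 + 2 = k + 3 by ring, Nat.factorial_succ k]
      push_cast
      have h3 : (k : ℝ) + 1 ≠ 0 := by positivity
      have h4 : (k.factorial : ℝ) ≠ 0 := by positivity
      have h5 : ((k + 3).factorial : ℝ) ≠ 0 := by positivity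
      field_simp
      ring
    have hs : Summable fun k : ℕ => (k : ℝ) * z ^ k
        / ((k.factorial : ℝ) * ((k + 2).factorial : ℝ)) := by
      rw [← summable_nat_add_iff 1]
      simp only [hterm]
      exact (summable_besselSeries 3 z).mul_left z
    refine ⟨?_, hs⟩
    rw [hs.tsum_eq_zero_add]
    simp only [hterm, besselSeries, CharP.cast_eq_zero, zero_mul, zero_div, zero_add, tsum_mul_left]
  rw [h3.1]
  simp only [besselSeries]
  rw [← tsum_mul_left, ← Summable.tsum_add h3.2 ((summable_besselSeries 2 z).mul_left 2)]
  refine tsum_congr fun k => ?_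
  have h1 := one_le_factorial_cast k
  have h2 := one_le_factorial_cast (k + 1)
  rw [show k + 2 = (k + 1) + 1 by ring, Nat.factorial_succ (k + 1)]
  push_cast
  have h3 : (k : ℝ) + 1 + 1 ≠ 0 := by positivity
  have h4 : (k.factorial : ℝ) ≠ 0 := by positivity
  have h5 : ((k + 1).factorial : ℝ) ≠ 0 := by positivity
  field_simp
  ring

theorem inv_factorial_le_besselSeries (m : ℕ) {z : ℝ} (hz : 0 ≤ z) :
    ((m.factorial : ℝ))⁻¹ ≤ besselSeries m z := by
  have h := (summable_besselSeries m z).le_tsum 0 (fun k _ => by positivity)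
  simpa [besselSeries] using h

theorem besselSeries_pos (m : ℕ) {z : ℝ} (hz : 0 ≤ z) : 0 < besselSeries m z :=
  lt_of_lt_of_le (by positivity) (inv_factorial_le_besselSeries m hz)

theorem besselI₁_eq_besselSeries (x : ℝ) : besselI₁ x = x / 2 * besselSeries 1 (x ^ 2 / 4) := by
  rw [besselI₁, besselSeries, ← tsum_mul_left]
  refine tsum_congr fun k => ?_
  rw [pow_succ, pow_mul, show (x / 2) ^ 2 = x ^ 2 / 4 by ring]
  ring

/-! ### Integral moments for `K₁` -/

/-- The moments `∫₀^∞ exp (-x cosh s) cosh s ^ n ds`. -/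
noncomputable def besselMoment (n : ℕ) (x : ℝ) : ℝ :=
  ∫ s in Set.Ioi (0 : ℝ), Real.exp (-x * Real.cosh s) * Real.cosh s ^ n

theorem besselK₁_eq_besselMoment (x : ℝ) : besselK₁ x = besselMoment 1 x := by
  simp [besselK₁, besselMoment]

/-- Half of the exponent absorbs `cosh s ^ n` through `u ^ n / n! ≤ exp u`; the other half decays
because `s ≤ cosh s`. -/
theorem exp_neg_mul_cosh_mul_cosh_pow_le (n : ℕ) {x s : ℝ} (hx : 0 < x) (hs : 0 ≤ s) :
    Real.exp (-x * Real.cosh s) * Real.cosh s ^ n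
      ≤ n.factorial * (2 / x) ^ n * Real.exp (-(x / 2) * s) := by
  have hc : 0 < Real.cosh s := Real.cosh_pos s
  have hsc : s ≤ Real.cosh s := (Real.self_le_sinh_iff.2 hs).trans (Real.sinh_lt_cosh s).le
  have h1 : Real.cosh s ^ n ≤ n.factorial * (2 / x) ^ n * Real.exp (x / 2 * Real.cosh s) := by
    have h := Real.pow_div_factorial_le_exp (x / 2 * Real.cosh s) (by positivity) n
    rw [div_le_iff₀ (by positivity)] at h
    have h2 : Real.cosh s ^ n = (2 / x) ^ n * (x / 2 * Real.cosh s) ^ n := by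
      rw [← mul_pow]; congr 1; field_simp
    rw [h2]
    calc _ ≤ (2 / x) ^ n * (Real.exp (x / 2 * Real.cosh s) * n.factorial) := by gcongr
      _ = _ := by ring
  calc _ ≤ Real.exp (-x * Real.cosh s)
        * (n.factorial * (2 / x) ^ n * Real.exp (x / 2 * Real.cosh s)) := by gcongr
    _ = n.factorial * (2 / x) ^ n * (Real.exp (-x * Real.cosh s) * Real.exp (x / 2 * Real.cosh s)) := by
      ring
    _ = n.factorial * (2 / x) ^ n * Real.exp (-(x / 2) * Real.cosh s) := by
      rw [← Real.exp_add]; congr 2; ring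
    _ ≤ _ := by
      gcongr ?_ * Real.exp ?_
      nlinarith

theorem integrableOn_besselMoment (n : ℕ) {x : ℝ} (hx : 0 < x) :
    IntegrableOn (fun s => Real.exp (-x * Real.cosh s) * Real.cosh s ^ n) (Set.Ioi 0) := by
  have hx2 : 0 < x / 2 := by positivity
  refine Integrable.mono' ((exp_neg_integrableOn_Ioi 0 hx2).const_mul (n.factorial * (2 / x) ^ n))
    (by fun_prop) ((ae_restrict_iff' measurableSet_Ioi).2 (Eventually.of_forall fun s hs => ?_))
  rw [Real.norm_of_nonneg (by have := Real.cosh_pos s; positivity)]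
  exact exp_neg_mul_cosh_mul_cosh_pow_le n hx (Set.mem_Ioi.1 hs).le

theorem tendsto_exp_neg_mul_cosh_mul_cosh_pow (n : ℕ) {x : ℝ} (hx : 0 < x) :
    Tendsto (fun s => Real.exp (-x * Real.cosh s) * Real.cosh s ^ n) atTop (𝓝 0) := by
  have h1 : Tendsto (fun s : ℝ => n.factorial * (2 / x) ^ n * Real.exp (-(x / 2) * s)) atTop (𝓝 0) := by
    have h2 : Tendsto (fun s : ℝ => Real.exp (-(x / 2) * s)) atTop (𝓝 0) :=
      Real.tendsto_exp_atBot.comp (tendsto_id.const_mul_atTop_of_neg (by linarith))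
    simpa using h2.const_mul (n.factorial * (2 / x) ^ n)
  refine squeeze_zero' (Eventually.of_forall fun s => ?_) ?_ h1
  · have := Real.cosh_pos s; positivity
  · filter_upwards [eventually_ge_atTop 0] with s hs
      using exp_neg_mul_cosh_mul_cosh_pow_le n hx hs

theorem hasDerivAt_besselMoment (n : ℕ) {x : ℝ} (hx : 0 < x) :
    HasDerivAt (besselMoment n) (-besselMoment (n + 1) x) x := by
  have hx2 : 0 < x / 2 := by positivity
  have h := hasDerivAt_integral_of_dominated_loc_of_deriv_le
    (μ := volume.restrict (Set.Ioi (0 : ℝ))) (s := Set.Ioi (x / 2)) (x₀ := x)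
    (F := fun x s => Real.exp (-x * Real.cosh s) * Real.cosh s ^ n)
    (F' := fun x s => -(Real.exp (-x * Real.cosh s) * Real.cosh s ^ (n + 1)))
    -- The integrand decreases in the parameter, so its value at `x / 2` dominates on a
    -- neighbourhood of `x`.
    (bound := fun s => Real.exp (-(x / 2) * Real.cosh s) * Real.cosh s ^ (n + 1))
    (Ioi_mem_nhds (by linarith)) (Eventually.of_forall fun y => by fun_prop)
    (integrableOn_besselMoment n hx) (by fun_prop)
    (Eventually.of_forall fun s y hy => by
      have hc := Real.cosh_pos s
      rw [norm_neg, Real.norm_of_nonneg (by positivity)]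
      gcongr
      exact (Set.mem_Ioi.1 hy).le)
    (integrableOn_besselMoment (n + 1) hx2)
    (Eventually.of_forall fun s y _ => by
      have h1 : HasDerivAt (fun x : ℝ => Real.exp (-x * Real.cosh s))
          (Real.exp (-y * Real.cosh s) * (-1 * Real.cosh s)) y :=
        ((hasDerivAt_id y).neg.mul_const (Real.cosh s)).exp
      exact (h1.mul_const (Real.cosh s ^ n)).congr_deriv (by ring))
  refine h.2.congr_deriv ?_
  rw [integral_neg]
  rfl

theorem besselMoment_pos (n : ℕ) {x : ℝ} (hx : 0 < x) : 0 < besselMoment n x := by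
  have hpos : ∀ s, 0 < Real.exp (-x * Real.cosh s) * Real.cosh s ^ n := fun s => by
    have := Real.cosh_pos s; positivity
  rw [besselMoment, setIntegral_pos_iff_support_of_nonneg_ae
    (Eventually.of_forall fun s => (hpos s).le) (integrableOn_besselMoment n hx)]
  have : (Function.support fun s => Real.exp (-x * Real.cosh s) * Real.cosh s ^ n) = Set.univ :=
    Set.eq_univ_of_forall fun s => (hpos s).ne'
  rw [this, Set.univ_inter, Real.volume_Ioi]
  exact ENNReal.zero_lt_top

/-- The modified Bessel equation of order one in terms of moments: the combined integrand is an
`s`-derivative whose primitive vanishes at `0` and at infinity. -/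
theorem besselMoment_recurrence {x : ℝ} (hx : 0 < x) :
    x ^ 2 * besselMoment 3 x - x * besselMoment 2 x - (x ^ 2 + 1) * besselMoment 1 x = 0 := by
  have i1 := integrableOn_besselMoment 1 hx
  have i2 := integrableOn_besselMoment 2 hx
  have i3 := integrableOn_besselMoment 3 hx
  have i32 := Integrable.sub' (i3.const_mul (x ^ 2)) (i2.const_mul x)
  have hlim : Tendsto (fun s => -(Real.exp (-x * Real.cosh s)
      * (x * (Real.sinh s * Real.cosh s) + Real.sinh s))) atTop (𝓝 0) := by
    have h2 : Tendsto (fun s => x * (Real.exp (-x * Real.cosh s) * Real.cosh s ^ 2)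
        + Real.exp (-x * Real.cosh s) * Real.cosh s ^ 1) atTop (𝓝 (x * 0 + 0)) :=
      ((tendsto_exp_neg_mul_cosh_mul_cosh_pow 2 hx).const_mul x).add
        (tendsto_exp_neg_mul_cosh_mul_cosh_pow 1 hx)
    rw [mul_zero, add_zero] at h2
    refine squeeze_zero_norm' ?_ h2
    filter_upwards [eventually_ge_atTop 0] with s hs
    have h0 : 0 ≤ Real.sinh s := Real.sinh_nonneg_iff.2 hs
    have h1 := (Real.sinh_lt_cosh s).le
    have hc := Real.cosh_pos s
    rw [norm_neg, Real.norm_of_nonneg (by positivity)]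
    calc _ ≤ Real.exp (-x * Real.cosh s) * (x * (Real.cosh s * Real.cosh s) + Real.cosh s) := by
          gcongr
      _ = _ := by ring
  have h := integral_Ioi_of_hasDerivAt_of_tendsto' (a := 0)
    (f := fun s => -(Real.exp (-x * Real.cosh s)
      * (x * (Real.sinh s * Real.cosh s) + Real.sinh s)))
    (f' := fun s => x ^ 2 * (Real.exp (-x * Real.cosh s) * Real.cosh s ^ 3)
      - x * (Real.exp (-x * Real.cosh s) * Real.cosh s ^ 2)
      - (x ^ 2 + 1) * (Real.exp (-x * Real.cosh s) * Real.cosh s ^ 1))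
    (fun s _ => by
      have h1 : HasDerivAt (fun s : ℝ => Real.exp (-x * Real.cosh s))
          (Real.exp (-x * Real.cosh s) * (-x * Real.sinh s)) s :=
        ((Real.hasDerivAt_cosh s).const_mul (-x)).exp
      have h2 : HasDerivAt (fun s : ℝ => x * (Real.sinh s * Real.cosh s) + Real.sinh s)
          (x * (Real.cosh s * Real.cosh s + Real.sinh s * Real.sinh s) + Real.cosh s) s :=
        (((Real.hasDerivAt_sinh s).fun_mul (Real.hasDerivAt_cosh s)).const_mul x).fun_add
          (Real.hasDerivAt_sinh s)
      refine (h1.fun_mul h2).fun_neg.congr_deriv ?_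
      linear_combination (Real.exp (-x * Real.cosh s) * -(x ^ 2 * Real.cosh s))
        * Real.cosh_sq s)
    (Integrable.sub' i32 (i1.const_mul (x ^ 2 + 1))) hlim
  rw [integral_sub i32 (i1.const_mul (x ^ 2 + 1)),
    integral_sub (i3.const_mul (x ^ 2)) (i2.const_mul x), integral_const_mul, integral_const_mul,
    integral_const_mul] at h
  simpa [besselMoment] using h

/-! ### Bessel functions as modal solutions -/

/-- `I₁ (μ t) / t` solves the modal equation with parameter `-μ ^ 2`. -/
theorem exists_derivatives_besselI₁_div (μ : ℝ) :
    ∃ f' f'' : ℝ → ℝ, ∀ t : ℝ, 0 < t →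
      HasDerivAt (fun t => besselI₁ (μ * t) / t) (f' t) t ∧ HasDerivAt f' (f'' t) t ∧
      f'' t + 3 / t * f' t - μ ^ 2 * (besselI₁ (μ * t) / t) = 0 ∧
      (0 < μ → μ / 2 ≤ besselI₁ (μ * t) / t ∧ 0 < f' t) := by
  -- Division by `t` cancels the odd factor of `I₁`, leaving an entire function of `t ^ 2`.
  have heq : ∀ t : ℝ, t ≠ 0 →
      besselI₁ (μ * t) / t = μ / 2 * besselSeries 1 (μ ^ 2 * t ^ 2 / 4) := by
    intro t ht
    rw [besselI₁_eq_besselSeries, mul_pow]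
    field_simp
  have harg : ∀ t : ℝ, HasDerivAt (fun t => μ ^ 2 * t ^ 2 / 4) (μ ^ 2 * t / 2) t := fun t =>
    (((hasDerivAt_pow 2 t).const_mul (μ ^ 2)).div_const 4).congr_deriv (by norm_num; ring)
  have hG : ∀ (m : ℕ) (t : ℝ), HasDerivAt (fun t => besselSeries m (μ ^ 2 * t ^ 2 / 4))
      (besselSeries (m + 1) (μ ^ 2 * t ^ 2 / 4) * (μ ^ 2 * t / 2)) t := fun m t =>
    (hasDerivAt_besselSeries m _).comp t (harg t)
  refine ⟨fun t => μ / 2 * (besselSeries 2 (μ ^ 2 * t ^ 2 / 4) * (μ ^ 2 / 2 * t)),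
    fun t => μ / 2 * (besselSeries 3 (μ ^ 2 * t ^ 2 / 4) * (μ ^ 2 * t / 2) * (μ ^ 2 / 2 * t)
      + besselSeries 2 (μ ^ 2 * t ^ 2 / 4) * (μ ^ 2 / 2)), fun t ht => ⟨?_, ?_, ?_, fun hμ => ⟨?_, ?_⟩⟩⟩
  · have h := (hG 1 t).const_mul (μ / 2)
    refine (h.congr_of_eventuallyEq ?_).congr_deriv (by ring)
    filter_upwards [eventually_ne_nhds ht.ne'] with s hs using heq s hs
  · refine ((hG 2 t).fun_mul ((hasDerivAt_id t).const_mul (μ ^ 2 / 2))).const_mul (μ / 2)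
      |>.congr_deriv ?_
    simp
  · rw [heq t ht.ne', ← besselSeries_recurrence]
    field_simp
    ring
  · rw [heq t ht.ne']
    have h := inv_factorial_le_besselSeries 1 (show 0 ≤ μ ^ 2 * t ^ 2 / 4 by positivity)
    simp only [Nat.factorial_one, Nat.cast_one, inv_one] at h
    exact le_mul_of_one_le_right (by positivity) h
  · have h := besselSeries_pos 2 (show 0 ≤ μ ^ 2 * t ^ 2 / 4 by positivity)
    positivity

/-- `K₁ (μ t) / t` solves the modal equation with parameter `-μ ^ 2`. -/
theorem exists_derivatives_besselK₁_div {μ : ℝ} (hμ : 0 < μ) :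
    ∃ f' f'' : ℝ → ℝ, ∀ t : ℝ, 0 < t →
      HasDerivAt (fun t => besselK₁ (μ * t) / t) (f' t) t ∧ HasDerivAt f' (f'' t) t ∧
      f'' t + 3 / t * f' t - μ ^ 2 * (besselK₁ (μ * t) / t) = 0 ∧
      0 < besselK₁ (μ * t) / t ∧ f' t < 0 := by
  have hM : ∀ (n : ℕ) (t : ℝ), 0 < t → HasDerivAt (fun t => besselMoment n (μ * t))
      (-besselMoment (n + 1) (μ * t) * μ) t := fun n t ht =>
    (hasDerivAt_besselMoment n (mul_pos hμ ht)).comp t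
      (((hasDerivAt_id t).const_mul μ).congr_deriv (mul_one μ))
  simp only [besselK₁_eq_besselMoment]
  refine ⟨fun t => -(μ * (besselMoment 2 (μ * t) / t) + besselMoment 1 (μ * t) / t ^ 2),
    fun t => -(μ * ((-besselMoment 3 (μ * t) * μ * t - besselMoment 2 (μ * t) * 1) / t ^ 2)
      + (-besselMoment 2 (μ * t) * μ * t ^ 2 - besselMoment 1 (μ * t) * (2 * t)) / (t ^ 2) ^ 2),
    fun t ht => ⟨?_, ?_, ?_, ?_, ?_⟩⟩
  · refine ((hM 1 t ht).div (hasDerivAt_id t) ht.ne').congr_deriv ?_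
    simp only [id]
    field_simp
    ring
  · have h1 := (hM 2 t ht).fun_div (hasDerivAt_id t) ht.ne'
    have h2 := (hM 1 t ht).fun_div (hasDerivAt_pow 2 t) (pow_ne_zero 2 ht.ne')
    simpa using ((h1.const_mul μ).fun_add h2).fun_neg
  · have h := besselMoment_recurrence (mul_pos hμ ht)
    field_simp
    linear_combination h
  · exact div_pos (besselMoment_pos 1 (mul_pos hμ ht)) ht
  · have h1 := besselMoment_pos 1 (mul_pos hμ ht)
    have h2 := besselMoment_pos 2 (mul_pos hμ ht)
    have : 0 < μ * (besselMoment 2 (μ * t) / t) + besselMoment 1 (μ * t) / t ^ 2 := by positivity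
    exact neg_neg_of_pos this

/-- `K₁` is decreasing, so `K₁ (μ t) ≤ K₁ μ` for `t ≥ 1` and the factor `1 / t` already suffices. -/
theorem tendsto_besselK₁_div {μ : ℝ} (hμ : 0 < μ) :
    Tendsto (fun t => besselK₁ (μ * t) / t) atTop (𝓝 0) := by
  simp only [besselK₁_eq_besselMoment]
  refine squeeze_zero' (g := fun t => besselMoment 1 μ * t⁻¹) ?_ ?_
    (by simpa using tendsto_inv_atTop_zero.const_mul (besselMoment 1 μ))
  · filter_upwards [eventually_gt_atTop 0] with t ht
    exact (div_pos (besselMoment_pos 1 (mul_pos hμ ht)) ht).le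
  · filter_upwards [eventually_ge_atTop 1] with t ht
    have ht0 : 0 < t := by linarith
    have hle : besselMoment 1 (μ * t) ≤ besselMoment 1 μ := by
      refine setIntegral_mono (integrableOn_besselMoment 1 (mul_pos hμ ht0))
        (integrableOn_besselMoment 1 hμ) fun s => ?_
      have hc := Real.cosh_pos s
      have hm : μ ≤ μ * t := le_mul_of_one_le_right hμ.le ht
      beta_reduce
      gcongr
    rw [div_eq_mul_inv]
    gcongr

/-! ### Linearity, uniqueness and spanning -/

theorem SolvesModalIVP.linear_combination {lam : ℂ} {t₀ a₁ b₁ a₂ b₂ : ℝ} {y₁ y₂ : ℝ → ℂ}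
    (h₁ : SolvesModalIVP lam t₀ a₁ b₁ y₁) (h₂ : SolvesModalIVP lam t₀ a₂ b₂ y₂) (c₁ c₂ : ℝ) :
    SolvesModalIVP lam t₀ (c₁ * a₁ + c₂ * a₂) (c₁ * b₁ + c₂ * b₂)
      (fun t => c₁ * y₁ t + c₂ * y₂ t) := by
  obtain ⟨p, p', hp, hp', hpe, hpa, hpb⟩ := h₁
  obtain ⟨q, q', hq, hq', hqe, hqa, hqb⟩ := h₂
  refine ⟨fun t => c₁ * p t + c₂ * q t, fun t => c₁ * p' t + c₂ * q' t,
    fun t ht => ((hp t ht).const_mul _).fun_add ((hq t ht).const_mul _),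
    fun t ht => ((hp' t ht).const_mul _).fun_add ((hq' t ht).const_mul _), fun t ht => ?_, ?_, ?_⟩
  · linear_combination (c₁ : ℂ) * hpe t ht + (c₂ : ℂ) * hqe t ht
  · simp [hpa, hqa]
  · simp [hpb, hqb]

/-- The solution with zero initial data vanishes. -/
theorem SolvesModalIVP.eq_zero {lam : ℂ} {t₀ : ℝ} (ht₀ : 0 < t₀) {y : ℝ → ℂ}
    (hy : SolvesModalIVP lam t₀ 0 0 y) : ∀ t ∈ Set.Ici t₀, y t = 0 := by
  obtain ⟨y', y'', hy', hy'', hode, ha, hb⟩ := hy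
  -- Energy `‖y‖ ^ 2 + ‖y'‖ ^ 2`: the damping term `3 / t` has the favourable sign and is discarded.
  have hanti := antitoneOn_mul_exp_of_deriv_le ht₀ (1 + ‖lam‖) 0
    (fun t ht => (hy' t ht).complex_normSq.fun_add (hy'' t ht).complex_normSq)
    (fun t ht => by
      have ht0 : 0 < t := ht₀.trans_le ht
      have h2 : y'' t = -lam * y t - (3 / t : ℝ) * y' t := by
        push_cast; linear_combination hode t ht
      have h3 : (starRingEnd ℂ (y' t) * y'' t).re
          = (starRingEnd ℂ (y' t) * (-lam * y t)).re - 3 / t * ‖y' t‖ ^ 2 := by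
        rw [h2, ← Complex.normSq_eq_norm_sq, Complex.normSq_apply]
        simp only [Complex.mul_re, Complex.sub_re, Complex.sub_im, Complex.mul_im, Complex.conj_re,
          Complex.conj_im, Complex.ofReal_re, Complex.ofReal_im]
        ring
      have h4 : (starRingEnd ℂ (y' t) * (-lam * y t)).re ≤ ‖lam‖ * (‖y t‖ * ‖y' t‖) := by
        refine (Complex.re_le_norm _).trans_eq ?_
        rw [norm_mul, norm_mul, norm_neg, Complex.norm_conj]
        ring
      have h5 : (starRingEnd ℂ (y t) * y' t).re ≤ ‖y t‖ * ‖y' t‖ := by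
        refine (Complex.re_le_norm _).trans_eq ?_
        rw [norm_mul, Complex.norm_conj]
      have h6 : 0 ≤ 3 / t * ‖y' t‖ ^ 2 := by positivity
      have h7 : 0 ≤ (1 + ‖lam‖) * (‖y t‖ - ‖y' t‖) ^ 2 := by positivity
      rw [h3, zero_div, add_zero]
      nlinarith)
  intro t ht
  have h := hanti Set.self_mem_Ici ht ht
  simp only [ha, hb, Complex.ofReal_zero, norm_zero] at h
  have h1 : (‖y t‖ ^ 2 + ‖y' t‖ ^ 2) ≤ 0 := by
    by_contra! hlt
    have := mul_pos hlt (Real.exp_pos (-(1 + ‖lam‖) * t + 0 / t))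
    linarith
  have h2 : ‖y t‖ ^ 2 = 0 := le_antisymm (by nlinarith [sq_nonneg ‖y' t‖]) (sq_nonneg _)
  simpa using h2

/-- Uniqueness for the modal initial value problem. -/
theorem SolvesModalIVP.unique {lam : ℂ} {t₀ a b : ℝ} (ht₀ : 0 < t₀) {y z : ℝ → ℂ}
    (hy : SolvesModalIVP lam t₀ a b y) (hz : SolvesModalIVP lam t₀ a b z) :
    ∀ t ∈ Set.Ici t₀, y t = z t := by
  intro t ht
  have h := hy.linear_combination hz 1 (-1)
  rw [show 1 * a + -1 * a = 0 by ring, show 1 * b + -1 * b = 0 by ring] at h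
  have h1 := h.eq_zero ht₀ t ht
  push_cast at h1
  linear_combination h1

/-- Two solutions with independent initial data span the space of solutions. -/
theorem SolvesModalIVP.exists_eq_linear_combination {lam : ℂ} {t₀ a b a₁ b₁ a₂ b₂ : ℝ}
    (ht₀ : 0 < t₀) {y y₁ y₂ : ℝ → ℂ} (hy : SolvesModalIVP lam t₀ a b y)
    (h₁ : SolvesModalIVP lam t₀ a₁ b₁ y₁) (h₂ : SolvesModalIVP lam t₀ a₂ b₂ y₂)
    (hdet : a₁ * b₂ - a₂ * b₁ ≠ 0) :
    ∃ c₁ c₂ : ℝ, (a = c₁ * a₁ + c₂ * a₂ ∧ b = c₁ * b₁ + c₂ * b₂) ∧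
      ∀ t ∈ Set.Ici t₀, y t = c₁ * y₁ t + c₂ * y₂ t := by
  -- Cramer's rule for the initial data.
  set c₁ := (a * b₂ - a₂ * b) / (a₁ * b₂ - a₂ * b₁) with hc₁
  set c₂ := (a₁ * b - a * b₁) / (a₁ * b₂ - a₂ * b₁) with hc₂
  have ha : a = c₁ * a₁ + c₂ * a₂ := by rw [hc₁, hc₂, div_mul_eq_mul_div, div_mul_eq_mul_div, ← add_div, eq_div_iff hdet]; ring
  have hb : b = c₁ * b₁ + c₂ * b₂ := by rw [hc₁, hc₂, div_mul_eq_mul_div, div_mul_eq_mul_div, ← add_div, eq_div_iff hdet]; ring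
  refine ⟨c₁, c₂, ⟨ha, hb⟩, hy.unique ht₀ ?_⟩
  have h := h₁.linear_combination h₂ c₁ c₂
  rwa [← ha, ← hb] at h

/-- Real solutions of the modal equation. -/
theorem solvesModalIVP_ofReal {m t₀ : ℝ} (ht₀ : 0 < t₀) {f f' f'' : ℝ → ℝ}
    (hf : ∀ t, 0 < t → HasDerivAt f (f' t) t) (hf' : ∀ t, 0 < t → HasDerivAt f' (f'' t) t)
    (hode : ∀ t, 0 < t → f'' t + 3 / t * f' t + m * f t = 0) :
    SolvesModalIVP (m : ℂ) t₀ (f t₀) (f' t₀) (fun t => (f t : ℂ)) := by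
  refine ⟨fun t => f' t, fun t => f'' t,
    fun t ht => (hf t (ht₀.trans_le ht)).ofReal_comp.hasDerivWithinAt,
    fun t ht => (hf' t (ht₀.trans_le ht)).ofReal_comp.hasDerivWithinAt, fun t ht => ?_, rfl, rfl⟩
  have h := congrArg Complex.ofReal (hode t (ht₀.trans_le ht))
  push_cast at h
  exact h

/-! ### Positive parameter -/

/-- For positive `lam`, the Liouville transform of a solution is bounded. -/
theorem SolvesModalIVP.exists_norm_liouville_le {lam t₀ a b : ℝ} (hlam : 0 < lam) (ht₀ : 0 < t₀)
    {y : ℝ → ℂ} (hy : SolvesModalIVP (lam : ℂ) t₀ a b y) :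
    ∃ M, ∀ t ∈ Set.Ici t₀, ‖((t ^ (3 / 2 : ℝ) : ℝ) : ℂ) * y t‖ ≤ M := by
  obtain ⟨w', hw, hw', -⟩ := hy.liouville ht₀
  set w : ℝ → ℂ := fun t => ((t ^ (3 / 2 : ℝ) : ℝ) : ℂ) * y t
  have hs : 0 < √lam := Real.sqrt_pos.2 hlam
  have hss : √lam ^ 2 = lam := Real.sq_sqrt hlam.le
  -- The `lam` terms cancel in the derivative of the energy; the rest is bounded by `2 ‖w‖ ‖w'‖ ≤
  -- (‖w'‖ ^ 2 + lam ‖w‖ ^ 2) / √lam`, which gives `c`.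
  obtain ⟨M, hM, hE⟩ := exists_le_mul_exp_of_deriv_le (c := 3 / (4 * √lam)) ht₀ 0 (by positivity)
    (fun t ht => (hw' t ht).complex_normSq.fun_add ((hw t ht).complex_normSq.const_mul lam))
    (fun t ht => by
      have ht0 : 0 < t := ht₀.trans_le ht
      have hq : (-(lam : ℂ) + 3 / (4 * (t : ℂ) ^ 2)) = ((-lam + 3 / (4 * t ^ 2) : ℝ) : ℂ) := by
        push_cast; ring
      have h1 : (starRingEnd ℂ (w' t) * ((-(lam : ℂ) + 3 / (4 * (t : ℂ) ^ 2)) * w t)).re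
          = (-lam + 3 / (4 * t ^ 2)) * (starRingEnd ℂ (w t) * w' t).re := by
        rw [hq]
        simp only [Complex.mul_re, Complex.mul_im, Complex.conj_re,
          Complex.conj_im, Complex.ofReal_re, Complex.ofReal_im]
        ring
      have h2 : (starRingEnd ℂ (w t) * w' t).re ≤ ‖w t‖ * ‖w' t‖ := by
        refine (Complex.re_le_norm _).trans_eq ?_
        rw [norm_mul, Complex.norm_conj]
      have h3 : 2 * (‖w t‖ * ‖w' t‖) ≤ (‖w' t‖ ^ 2 + lam * ‖w t‖ ^ 2) / √lam := by
        rw [le_div_iff₀ hs]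
        nlinarith [sq_nonneg (‖w' t‖ - √lam * ‖w t‖)]
      rw [h1]
      calc _ = 3 / (4 * t ^ 2) * (2 * (starRingEnd ℂ (w t) * w' t).re) := by ring
        _ ≤ 3 / (4 * t ^ 2) * ((‖w' t‖ ^ 2 + lam * ‖w t‖ ^ 2) / √lam) := by
          gcongr; linarith
        _ = _ := by field_simp; ring)
  refine ⟨√(M / lam), fun t ht => Real.le_sqrt_of_sq_le ?_⟩
  have h := hE t ht
  rw [zero_mul, Real.exp_zero, mul_one] at h
  rw [le_div_iff₀ hlam]
  nlinarith [sq_nonneg ‖w' t‖]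

theorem SolvesModalIVP.isBigO {lam t₀ a b : ℝ} (hlam : 0 < lam) (ht₀ : 0 < t₀)
    {y : ℝ → ℂ} (hy : SolvesModalIVP (lam : ℂ) t₀ a b y) :
    y =O[atTop] (fun t : ℝ => t ^ (-(3 / 2) : ℝ)) := by
  obtain ⟨M, hM⟩ := hy.exists_norm_liouville_le hlam ht₀
  refine IsBigO.of_bound M ?_
  filter_upwards [eventually_ge_atTop t₀] with t ht
  have ht0 : 0 < t := ht₀.trans_le ht
  have hpt : 0 < t ^ (3 / 2 : ℝ) := Real.rpow_pos_of_pos ht0 _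
  have h := hM t ht
  rw [norm_mul, Complex.norm_real, Real.norm_of_nonneg hpt.le] at h
  rw [Real.rpow_neg ht0.le, norm_inv, Real.norm_of_nonneg hpt.le, ← div_eq_mul_inv,
    le_div_iff₀ hpt]
  linarith

/-- If the Liouville transform tends to zero, then so does the function. -/
theorem tendsto_zero_of_liouville {y : ℝ → ℂ}
    (h : Tendsto (fun t : ℝ => ((t ^ (3 / 2 : ℝ) : ℝ) : ℂ) * y t) atTop (𝓝 0)) :
    Tendsto y atTop (𝓝 0) := by
  refine squeeze_zero_norm' ?_ (tendsto_zero_iff_norm_tendsto_zero.1 h)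
  filter_upwards [eventually_ge_atTop 1] with t ht
  have h1 : 1 ≤ t ^ (3 / 2 : ℝ) := Real.one_le_rpow ht (by norm_num)
  rw [norm_mul, Complex.norm_real, Real.norm_of_nonneg (by linarith)]
  exact le_mul_of_one_le_left (norm_nonneg _) h1

/-! ### Non-real parameter -/

/-- For non-real `lam` and nonzero real initial data the solution grows exponentially. -/
theorem SolvesModalIVP.growth_of_im_ne_zero {κ : ℂ} {t₀ a b : ℝ} (hκ : 0 < κ.re)
    (him : (κ ^ 2).im ≠ 0) (ht₀ : 0 < t₀) (hab : (a, b) ≠ (0, 0)) {y : ℝ → ℂ}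
    (hy : SolvesModalIVP (-κ ^ 2) t₀ a b y) :
    GrowsExponentiallyAtRate (fun t => ‖y t‖) κ.re ∧
      ∃ C : ℝ, 0 < C ∧ (fun t => ‖y t‖) ~[atTop]
        (fun t : ℝ => C * (Real.exp (κ.re * t) * t ^ (-(3 / 2) : ℝ))) := by
  obtain ⟨w', hw, hw', hw₀⟩ := hy.liouville ht₀
  obtain ⟨y', y'', -, -, -, ha, -⟩ := hy
  rw [neg_neg] at hw'
  set w : ℝ → ℂ := fun t => ((t ^ (3 / 2 : ℝ) : ℝ) : ℂ) * y t with hw_def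
  obtain ⟨A, hA, hA0⟩ := exists_tendsto_exp_neg_mul hκ ht₀ hw hw'
  refine growth_of_tendsto_amplitude hκ (fun h0 => hab ?_) hA
  obtain ⟨h1, h2⟩ := hA0 h0
  have hpt : ((t₀ ^ (3 / 2 : ℝ) : ℝ) : ℂ) ≠ 0 := by
    exact_mod_cast (Real.rpow_pos_of_pos ht₀ _).ne'
  -- The real potential `3 / (4 t ^ 2)` drops out of the derivative of `conj w * w'` after taking
  -- imaginary parts; the factor `-(κ ^ 2).im` makes `G` decreasing whatever the sign of `(κ ^
  -- 2).im`.
  set G : ℝ → ℝ := fun t => -(κ ^ 2).im * (starRingEnd ℂ (w t) * w' t).im with hG_def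
  have hG : ∀ t ∈ Set.Ici t₀,
      HasDerivWithinAt G (-((κ ^ 2).im ^ 2 * ‖w t‖ ^ 2)) (Set.Ici t₀) t := by
    intro t ht
    have hconj : HasDerivWithinAt (fun t => starRingEnd ℂ (w t)) (starRingEnd ℂ (w' t))
        (Set.Ici t₀) t := (hw t ht).star
    have him : HasDerivWithinAt (fun t => (starRingEnd ℂ (w t) * w' t).im)
        (starRingEnd ℂ (w' t) * w' t
          + starRingEnd ℂ (w t) * ((κ ^ 2 + 3 / (4 * (t : ℂ) ^ 2)) * w t)).im (Set.Ici t₀) t :=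
      Complex.imCLM.hasFDerivAt.comp_hasDerivWithinAt t (hconj.fun_mul (hw' t ht))
    refine (him.const_mul (-(κ ^ 2).im)).congr_deriv ?_
    have hq : 3 / (4 * (t : ℂ) ^ 2) = ((3 / (4 * t ^ 2) : ℝ) : ℂ) := by push_cast; ring
    rw [hq, ← Complex.normSq_eq_norm_sq, Complex.normSq_apply]
    generalize κ ^ 2 = k
    simp only [Complex.mul_re, Complex.add_re, Complex.add_im, Complex.mul_im, Complex.conj_re,
      Complex.conj_im, Complex.ofReal_re, Complex.ofReal_im]
    ring
  have hanti : AntitoneOn G (Set.Ici t₀) := antitoneOn_Ici_of_hasDerivWithinAt_nonpos hG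
    fun t _ => neg_nonpos.2 (by positivity)
  -- Real data make `w t₀` and `w' t₀` real.
  have hG₀ : G t₀ = 0 := by
    simp only [hG_def, hw_def, hw₀, ha]
    simp [Complex.mul_im, Complex.div_im]
  have hGlim : Tendsto G atTop (𝓝 0) := by
    have h3 : Tendsto (fun t => starRingEnd ℂ (w t) * w' t) atTop (𝓝 0) := by
      simpa using ((Complex.continuous_conj.tendsto 0).comp h1).mul h2
    have h4 := ((Complex.continuous_im.tendsto 0).comp h3).const_mul (-(κ ^ 2).im)
    rw [Complex.zero_im, mul_zero] at h4
    exact h4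
  have hGz : ∀ t ∈ Set.Ici t₀, G t = 0 := by
    intro t ht
    refine le_antisymm (hG₀ ▸ hanti Set.self_mem_Ici ht ht) (le_of_tendsto hGlim ?_)
    filter_upwards [eventually_ge_atTop t] with s hs
    exact hanti ht (Set.mem_Ici.2 (le_trans ht hs)) hs
  have hwz : ∀ t ∈ Set.Ici t₀, w t = 0 := by
    intro t ht
    have h5 : HasDerivWithinAt G 0 (Set.Ici t₀) t :=
      (hasDerivWithinAt_const t (Set.Ici t₀) (0 : ℝ)).congr hGz (hGz t ht)
    have h6 := (uniqueDiffOn_Ici t₀ t ht).eq_deriv _ (hG t ht) h5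
    have h7 : (κ ^ 2).im ^ 2 ≠ 0 := pow_ne_zero 2 him
    simpa [h7] using h6
  have haz : a = 0 := by
    have := hwz t₀ Set.self_mem_Ici
    simp only [hw_def, ha, mul_eq_zero, hpt, false_or] at this
    exact_mod_cast this
  have hbz : b = 0 := by
    have h5 : HasDerivWithinAt w 0 (Set.Ici t₀) t₀ :=
      (hasDerivWithinAt_const t₀ (Set.Ici t₀) (0 : ℂ)).congr hwz (hwz t₀ Set.self_mem_Ici)
    have h6 := (uniqueDiffOn_Ici t₀ t₀ Set.self_mem_Ici).eq_deriv _ (hw t₀ Set.self_mem_Ici) h5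
    rw [hw₀, haz] at h6
    simp only [Complex.ofReal_zero, mul_zero, add_zero, mul_eq_zero, hpt, false_or] at h6
    exact_mod_cast h6
  rw [haz, hbz]

theorem principalSqrt_sq (z : ℂ) : principalSqrt z ^ 2 = z := by
  rw [principalSqrt, one_div]
  exact_mod_cast Complex.cpow_nat_inv_pow z two_ne_zero

theorem principalSqrt_im_ne_zero {z : ℂ} (hz : z.im ≠ 0) : (principalSqrt z).im ≠ 0 := by
  intro h
  apply hz
  rw [← principalSqrt_sq z, sq, Complex.mul_im, h]
  ring

/-- A square root of `-z` whose real part is the modulus of the imaginary part of the principal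
square root of `z`. -/
theorem exists_sq_eq_neg_re_eq_abs_im_principalSqrt (z : ℂ) :
    ∃ κ : ℂ, z = -κ ^ 2 ∧ κ.re = |(principalSqrt z).im| := by
  have h : (Complex.I * principalSqrt z) ^ 2 = -z := by
    rw [mul_pow, principalSqrt_sq, Complex.I_sq, neg_one_mul]
  rcases abs_cases (principalSqrt z).im with ⟨h1, -⟩ | ⟨h1, -⟩
  · exact ⟨-(Complex.I * principalSqrt z), by rw [neg_sq, h, neg_neg], by rw [h1]; simp⟩
  · exact ⟨Complex.I * principalSqrt z, by rw [h, neg_neg], by rw [h1]; simp⟩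

/-! ### Negative and zero parameters -/

/-- For `lam = -μ ^ 2`, solutions are combinations of `I₁ (μ t) / t` and `K₁ (μ t) / t`, and they
grow exponentially unless the initial data are proportional to those of the latter. -/
theorem modalIVP_neg_sq {μ t₀ : ℝ} (hμ : 0 < μ) (ht₀ : 0 < t₀) :
    (∀ a b : ℝ, ∀ y : ℝ → ℂ, SolvesModalIVP (-(μ : ℂ) ^ 2) t₀ a b y →
      ∃ c₁ c₂ : ℝ, ∀ t : ℝ, t₀ ≤ t →
        y t = (((c₁ * besselI₁ (μ * t) + c₂ * besselK₁ (μ * t)) / t : ℝ) : ℂ)) ∧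
    ∃ L : Submodule ℝ (ℝ × ℝ),
      Module.finrank ℝ L = 1 ∧ volume (L : Set (ℝ × ℝ)) = 0 ∧
      ∀ a b : ℝ, (a, b) ∉ L →
        ∀ y : ℝ → ℂ, SolvesModalIVP (-(μ : ℂ) ^ 2) t₀ a b y →
          GrowsExponentiallyAtRate (fun t => ‖y t‖) μ ∧
          ∃ C : ℝ, 0 < C ∧
            (fun t => ‖y t‖) ~[atTop]
              (fun t : ℝ => C * (Real.exp (μ * t) * t ^ (-(3 / 2) : ℝ))) := by
  obtain ⟨f', f'', hf⟩ := exists_derivatives_besselI₁_div μ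
  obtain ⟨g', g'', hg⟩ := exists_derivatives_besselK₁_div hμ
  have hI := solvesModalIVP_ofReal (m := -μ ^ 2) ht₀ (fun t ht => (hf t ht).1)
    (fun t ht => (hf t ht).2.1) (fun t ht => by linarith [(hf t ht).2.2.1])
  have hK := solvesModalIVP_ofReal (m := -μ ^ 2) ht₀ (fun t ht => (hg t ht).1)
    (fun t ht => (hg t ht).2.1) (fun t ht => by linarith [(hg t ht).2.2.1])
  rw [Complex.ofReal_neg, Complex.ofReal_pow] at hI hK
  obtain ⟨-, -, -, hK0, hK0'⟩ := hg t₀ ht₀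
  have hI0 := ((hf t₀ ht₀).2.2.2 hμ).1
  have hI0' := ((hf t₀ ht₀).2.2.2 hμ).2
  -- The Wronskian at `t₀` is negative: both solutions are positive, one increasing and the other
  -- decreasing.
  have hdet : besselI₁ (μ * t₀) / t₀ * g' t₀ - besselK₁ (μ * t₀) / t₀ * f' t₀ ≠ 0 := by
    have h1 : 0 < besselI₁ (μ * t₀) / t₀ := lt_of_lt_of_le (by positivity) hI0
    have h2 := mul_neg_of_pos_of_neg h1 hK0'
    have h3 := mul_pos hK0 hI0'
    exact ne_of_lt (by linarith)
  refine ⟨fun a b y hy => ?_, Submodule.span ℝ {(besselK₁ (μ * t₀) / t₀, g' t₀)}, ?_, ?_, ?_⟩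
  · obtain ⟨c₁, c₂, -, hc⟩ := hy.exists_eq_linear_combination ht₀ hI hK hdet
    refine ⟨c₁, c₂, fun t ht => ?_⟩
    rw [hc t ht]
    push_cast
    ring
  · exact finrank_span_singleton fun h => hK0.ne' (congrArg Prod.fst h)
  · refine Measure.addHaar_submodule volume _ fun h => ?_
    have h1 : Module.finrank ℝ (Submodule.span ℝ {(besselK₁ (μ * t₀) / t₀, g' t₀)}) = 1 :=
      finrank_span_singleton fun h => hK0.ne' (congrArg Prod.fst h)
    rw [h, finrank_top, Module.finrank_prod, Module.finrank_self] at h1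
    norm_num at h1
  · intro a b hab y hy
    obtain ⟨c₁, c₂, ⟨hca, hcb⟩, hc⟩ := hy.exists_eq_linear_combination ht₀ hI hK hdet
    obtain ⟨w', hw, hw', -⟩ := hy.liouville ht₀
    rw [neg_neg] at hw'
    have hκ : 0 < (μ : ℂ).re := hμ
    obtain ⟨A, hA, hA0⟩ := exists_tendsto_exp_neg_mul hκ ht₀ hw hw'
    refine growth_of_tendsto_amplitude hκ (fun h0 => hab ?_) hA
    have hy0 := tendsto_zero_of_liouville (hA0 h0).1
    have hK0 := (Complex.continuous_ofReal.tendsto 0).comp (tendsto_besselK₁_div hμ)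
    have hI0 : Tendsto (fun t : ℝ => (c₁ : ℂ) * ((besselI₁ (μ * t) / t : ℝ) : ℂ)) atTop (𝓝 0) := by
      have h1 := hy0.sub (hK0.const_mul (c₂ : ℂ))
      rw [Complex.ofReal_zero, mul_zero, sub_zero] at h1
      refine h1.congr' ?_
      filter_upwards [eventually_ge_atTop t₀] with t ht
      rw [hc t ht]
      simp
    -- `c₁ * I₁ (μ t) / t` tends to zero although `I₁ (μ t) / t ≥ μ / 2`.
    have hc₁ : |c₁| * (μ / 2) ≤ 0 := by
      refine ge_of_tendsto (tendsto_zero_iff_norm_tendsto_zero.1 hI0) ?_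
      filter_upwards [eventually_gt_atTop 0] with t ht
      rw [norm_mul, Complex.norm_real, Complex.norm_real, Real.norm_eq_abs, Real.norm_eq_abs]
      gcongr
      exact ((hf t ht).2.2.2 hμ).1.trans (le_abs_self _)
    have hc₁0 : c₁ = 0 := by
      by_contra hne
      have := mul_pos (abs_pos.2 hne) (half_pos hμ)
      linarith
    rw [Submodule.mem_span_singleton]
    exact ⟨c₂, by simp [hca, hcb, hc₁0]⟩

theorem SolvesModalIVP.eq_of_zero {t₀ a b : ℝ} (ht₀ : 0 < t₀) {y : ℝ → ℂ}
    (hy : SolvesModalIVP 0 t₀ a b y) :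
    ∃ c₁ c₂ : ℂ, (∀ t : ℝ, t₀ ≤ t → y t = c₁ + c₂ * ((t : ℂ) ^ 2)⁻¹) ∧
      Tendsto y atTop (𝓝 c₁) := by
  -- Obtained by matching `e + d t ^ (-2)` and its derivative `-2 d t ^ (-3)` to the data at `t₀`.
  set d := -(t₀ ^ 3 * b) / 2 with hd
  set e := a - d * (t₀ ^ 2)⁻¹ with he
  have hinv : ∀ (n : ℕ) (t : ℝ), 0 < t →
      HasDerivAt (fun t : ℝ => (t ^ (n + 1))⁻¹) (-((n + 1 : ℕ) : ℝ) * (t ^ (n + 2))⁻¹) t := by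
    intro n t ht
    refine ((hasDerivAt_pow (n + 1) t).fun_inv (pow_ne_zero _ ht.ne')).congr_deriv ?_
    rw [Nat.add_sub_cancel]
    field_simp
    ring
  have hz := solvesModalIVP_ofReal (m := 0) ht₀ (f := fun t => e + d * (t ^ 2)⁻¹)
    (f' := fun t => d * (-((1 + 1 : ℕ) : ℝ) * (t ^ 3)⁻¹))
    (f'' := fun t => d * (-((1 + 1 : ℕ) : ℝ) * (-((2 + 1 : ℕ) : ℝ) * (t ^ 4)⁻¹)))
    (fun t ht => ((hinv 1 t ht).const_mul d).const_add e)
    (fun t ht => ((hinv 2 t ht).const_mul _).const_mul d)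
    (fun t ht => by field_simp; norm_num)
  have ha : e + d * (t₀ ^ 2)⁻¹ = a := by rw [he]; ring
  have hb : d * (-((1 + 1 : ℕ) : ℝ) * (t₀ ^ 3)⁻¹) = b := by rw [hd]; push_cast; field_simp
  simp only [ha, hb, Complex.ofReal_zero] at hz
  have hyz : ∀ t : ℝ, t₀ ≤ t → y t = (e : ℂ) + (d : ℂ) * ((t : ℂ) ^ 2)⁻¹ := fun t ht => by
    rw [hy.unique ht₀ hz t ht]
    push_cast
    rfl
  refine ⟨e, d, hyz, ?_⟩
  have h1 : Tendsto (fun t : ℝ => e + d * (t ^ 2)⁻¹) atTop (𝓝 (e + d * 0)) :=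
    ((tendsto_pow_atTop two_ne_zero).inv_tendsto_atTop.const_mul d).const_add e
  rw [mul_zero, add_zero] at h1
  refine ((Complex.continuous_ofReal.tendsto e).comp h1).congr' ?_
  filter_upwards [eventually_ge_atTop t₀] with t ht
  rw [hyz t ht]
  simp

theorem mainTheorem2 (t₀ : ℝ) (ht₀ : 0 < t₀) :
    -- (i) positive real parameter
    (∀ lam : ℝ, 0 < lam → ∀ a b : ℝ, (a, b) ≠ (0, 0) →
      ∀ y : ℝ → ℂ, SolvesModalIVP (lam : ℂ) t₀ a b y →
        y =O[atTop] (fun t : ℝ => t ^ (-(3 / 2) : ℝ)) ∧ Tendsto y atTop (𝓝 0)) ∧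
    -- (ii) negative real parameter `-μ²`
    (∀ μ : ℝ, 0 < μ →
      (∀ a b : ℝ, (a, b) ≠ (0, 0) →
        ∀ y : ℝ → ℂ, SolvesModalIVP (-(μ : ℂ) ^ 2) t₀ a b y →
          ∃ c₁ c₂ : ℝ, ∀ t : ℝ, t₀ ≤ t →
            y t = (((c₁ * besselI₁ (μ * t) + c₂ * besselK₁ (μ * t)) / t : ℝ) : ℂ)) ∧
      ∃ L : Submodule ℝ (ℝ × ℝ),
        Module.finrank ℝ L = 1 ∧ volume (L : Set (ℝ × ℝ)) = 0 ∧
        ∀ a b : ℝ, (a, b) ∉ L →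
          ∀ y : ℝ → ℂ, SolvesModalIVP (-(μ : ℂ) ^ 2) t₀ a b y →
            GrowsExponentiallyAtRate (fun t => ‖y t‖) μ ∧
            ∃ C : ℝ, 0 < C ∧
              (fun t => ‖y t‖) ~[atTop]
                (fun t : ℝ => C * (Real.exp (μ * t) * t ^ (-(3 / 2) : ℝ)))) ∧
    -- (iii) non-real parameter
    (∀ lam : ℂ, lam.im ≠ 0 →
      0 < |(principalSqrt lam).im| ∧
      ∀ a b : ℝ, (a, b) ≠ (0, 0) →
        ∀ y : ℝ → ℂ, SolvesModalIVP lam t₀ a b y →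
          GrowsExponentiallyAtRate (fun t => ‖y t‖) |(principalSqrt lam).im| ∧
          ∃ C : ℝ, 0 < C ∧
            (fun t => ‖y t‖) ~[atTop]
              (fun t : ℝ =>
                C * (Real.exp (|(principalSqrt lam).im| * t) * t ^ (-(3 / 2) : ℝ)))) ∧
    -- (iv) zero parameter
    (∀ a b : ℝ, (a, b) ≠ (0, 0) →
      ∀ y : ℝ → ℂ, SolvesModalIVP 0 t₀ a b y →
        ∃ c₁ c₂ : ℂ, (∀ t : ℝ, t₀ ≤ t → y t = c₁ + c₂ * ((t : ℂ) ^ 2)⁻¹) ∧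
          Tendsto y atTop (𝓝 c₁)) := by
  refine ⟨fun lam hlam a b _ y hy => ?_, fun μ hμ => ?_, fun lam hlam => ?_,
    fun a b _ y hy => hy.eq_of_zero ht₀⟩
  · have h := hy.isBigO hlam ht₀
    exact ⟨h, h.trans_tendsto (tendsto_rpow_neg_atTop (by norm_num))⟩
  · obtain ⟨h1, h2⟩ := modalIVP_neg_sq hμ ht₀
    exact ⟨fun a b _ => h1 a b, h2⟩
  · have hpos := abs_pos.2 (principalSqrt_im_ne_zero hlam)
    obtain ⟨κ, hκ, hre⟩ := exists_sq_eq_neg_re_eq_abs_im_principalSqrt lam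
    refine ⟨hpos, fun a b hab y hy => ?_⟩
    rw [← hre]
    rw [hκ] at hy
    refine hy.growth_of_im_ne_zero (hre ▸ hpos) (fun h => hlam ?_) ht₀ hab
    rw [hκ, Complex.neg_im, h, neg_zero]
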